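/- Let $K$ be a field. For a $K$-linear category $\mathcal C$ let $\mathrm{Mod}(\mathcal C)$ be the category of covariant $K$-linear functors from $\mathcal C$ to $K$-vector spaces, and let $\mathrm{mod}(\mathcal C)$ be its full subcategory of finitely presented objects, i.e. of those $N$ for which there is an exact sequence $P_1\to P_0\to N\to 0$ with $P_0,P_1$ finitely generated projective. Let $\mathbb D_{\mathcal C}:\mathrm{Mod}(\mathcal C)\to\mathrm{Mod}(\mathcal C^{op})$ be the contravariant functor $\mathbb D_{\mathcal C}(N)(C)=\mathrm{Hom}_K(N(C),K)$. A *dualizing $K$-variety* is a skeletally small additive $K$-category $\mathcal C$ with split idempotents and finite-dimensional spaces of morphisms such that $\mathbb D_{\mathcal C}$ restricts to a duality $\mathrm{mod}(\mathcal C)\to\mathrm{mod}(\mathcal C^{op})$. Let $\mathcal U$ and $\mathcal T$ be $K$-linear categories and $M\in\mathrm{Mod}(\mathcal U\otimes_K\mathcal T^{op})$, where the objects of $\mathcal U\otimes_K\mathcal T^{op}$ are the pairs $(U,T)$ and its morphism spaces are $\mathcal U(U,U')\otimes_K\mathcal T^{op}(T,T')$. Put $M_T=M(-,T)\in\mathrm{Mod}(\mathcal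 U)$ and $M_U=M(U,-)\in\mathrm{Mod}(\mathcal T^{op})$. * The triangular matrix category $\mathbf\Lambda=\left[\begin{smallmatrix}\mathcal T&0\\M&\mathcal U\end{smallmatrix}\right]$ has as objects the pairs $(T,U)$; a morphism $(T,U)\to(T',U')$ is a matrix $\left[\begin{smallmatrix}t&0\\m&u\end{smallmatrix}\right]$ with $t\in\mathcal T(T,T')$, $u\in\mathcal U(U,U')$, $m\in M(U',T)$, and the composition is $\left[\begin{smallmatrix}t_2&0\\m_2&u_2\end{smallmatrix}\right]\circ\left[\begin{smallmatrix}t_1&0\\m_1&u_1\end{smallmatrix}\right]=\left[\begin{smallmatrix}t_2t_1&0\\m_2\bullet t_1+u_2\bullet m_1&u_2u_1\end{smallmatrix}\right]$, where $m_2\bullet t_1=M(1\otimes t_1^{op})(m_2)$ and $u_2\bullet m_1=M(u_2\otimes 1)(m_1)$. * $\mathbb G:\mathrm{Mod}(\mathcal U)\to\mathrm{Mod}(\mathcal T)$ is the functor $\mathbb G(B)(T)=\mathrm{Hom}_{\mathrm{Mod}(\mathcal U)}(M_T,B)$. The comma category $(\mathrm{Mod}(\mathcal T),\mathbb G\,\mathrm{Mod}(\mathcal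 U))$ consists of the triples $(A,f,B)$ with $f:A\to\mathbb G(B)$, and $(\mathrm{mod}(\mathcal T),\mathbb G\,\mathrm{mod}(\mathcal U))$ is its full subcategory of the triples with $A\in\mathrm{mod}(\mathcal T)$ and $B\in\mathrm{mod}(\mathcal U)$. * $\mathfrak F:(\mathrm{Mod}(\mathcal T),\mathbb G\,\mathrm{Mod}(\mathcal U))\to\mathrm{Mod}(\mathbf\Lambda)$ sends $(A,f,B)$ to the $\mathbf\Lambda$-module $(T,U)\mapsto A(T)\oplus B(U)$ on which $\left[\begin{smallmatrix}t&0\\m&u\end{smallmatrix}\right]:(T,U)\to(T',U')$ acts by $(x,y)\mapsto\bigl(A(t)(x),\,[f_T(x)]_{U'}(m)+B(u)(y)\bigr)$, and it sends $(\alpha,\beta)$ to $\alpha\oplus\beta$. * $\overline M\in\mathrm{Mod}(\mathcal T^{op}\otimes_K\mathcal U)$ is given by $\overline M(T,U)=M(U,T)$; let $\overline{\mathbf\Lambda}=\left[\begin{smallmatrix}\mathcal U^{op}&0\\\overline M&\mathcal T^{op}\end{smallmatrix}\right]$, and let $\overline{\mathbb G}:\mathrm{Mod}(\mathcal T^{op})\to\mathrm{Mod}(\mathcal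 U^{op})$, $\overline{\mathbb G}(A)(U)=\mathrm{Hom}_{\mathrm{Mod}(\mathcal T^{op})}(M_U,A)$, and $\overline{\mathfrak F}:(\mathrm{Mod}(\mathcal U^{op}),\overline{\mathbb G}\,\mathrm{Mod}(\mathcal T^{op}))\to\mathrm{Mod}(\overline{\mathbf\Lambda})$ be the functors attached to $\overline M$ in the same way. * $\mathbb T^*:\mathrm{Mod}(\overline{\mathbf\Lambda})\to\mathrm{Mod}(\mathbf\Lambda^{op})$ is the functor induced by the isomorphism $\mathbf\Lambda^{op}\cong\overline{\mathbf\Lambda}$, $(T,U)\mapsto(U,T)$, $\left[\begin{smallmatrix}t&0\\m&u\end{smallmatrix}\right]^{op}\mapsto\left[\begin{smallmatrix}u^{op}&0\\m&t^{op}\end{smallmatrix}\right]$. * $\widehat\Theta:(\mathrm{Mod}(\mathcal T),\mathbb G\,\mathrm{Mod}(\mathcal U))\to(\mathrm{Mod}(\mathcal U^{op}),\overline{\mathbb G}\,\mathrm{Mod}(\mathcal T^{op}))$ is the contravariant functor sending $(A,f,B)$ to $(\mathbb D_{\mathcal U}(B),\overline f,\mathbb D_{\mathcal T}(A))$ and $(\alpha,\beta)$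 to $(\mathbb D_{\mathcal U}(\beta),\mathbb D_{\mathcal T}(\alpha))$. Here $\overline f=\overline{\mathbb G}(\mathbb D_{\mathcal T}(f))\circ\Psi_B$, where $\Psi_B:\mathbb D_{\mathcal U}(B)\to\overline{\mathbb G}(\mathbb D_{\mathcal T}(\mathbb G(B)))$ sends a linear map $s:B(U)\to K$ to the morphism $M_U\to\mathbb D_{\mathcal T}(\mathbb G(B))$ that maps $m\in M(U,T)$ to the linear map $\mathrm{Hom}(M_T,B)\to K$, $\eta\mapsto s(\eta_U(m))$. **Proposition.** Suppose that $\mathcal U$ and $\mathcal T$ are dualizing $K$-varieties and that $M_T\in\mathrm{mod}(\mathcal U)$ for all $T\in\mathcal T$ and $M_U\in\mathrm{mod}(\mathcal T^{op})$ for all $U\in\mathcal U$. Then $\mathfrak F$, $\widehat\Theta$, $\mathbb T^*\circ\overline{\mathfrak F}$ and $\mathbb D_{\mathbf\Lambda}$ restrict to functors $$(\mathrm{mod}(\mathcal T),\mathbb G\,\mathrm{mod}(\mathcal U))\to\mathrm{mod}(\mathbf\Lambda),\qquad(\mathrm{mod}(\mathcal T),\mathbb G\,\mathrm{mod}(\mathcal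 U))\to(\mathrm{mod}(\mathcal U^{op}),\overline{\mathbb G}\,\mathrm{mod}(\mathcal T^{op})),$$ $$(\mathrm{mod}(\mathcal U^{op}),\overline{\mathbb G}\,\mathrm{mod}(\mathcal T^{op}))\to\mathrm{mod}(\mathbf\Lambda^{op}),\qquad\mathrm{mod}(\mathbf\Lambda)\to\mathrm{mod}(\mathbf\Lambda^{op})$$ (the second and the fourth being contravariant), and there is a natural isomorphism of contravariant functors $$\nu:\mathbb T^*\circ\overline{\mathfrak F}\circ\widehat\Theta\;\xrightarrow{\ \sim\ }\;\mathbb D_{\mathbf\Lambda}\circ\mathfrak F:(\mathrm{mod}(\mathcal T),\mathbb G\,\mathrm{mod}(\mathcal U))\longrightarrow\mathrm{mod}(\mathbf\Lambda^{op}).$$ Moreover the restriction $\mathrm{mod}(\mathbf\Lambda)\to\mathrm{mod}(\mathbf\Lambda^{op})$ of $\mathbb D_{\mathbf\Lambda}$ is a duality, and $\mathbf\Lambda$ is a dualizing $K$-variety. -/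

import Mathlib

open CategoryTheory Opposite TensorProduct

universe s w v v₁ v₂ u u₁ u₂

namespace TriangularMatrix

noncomputable section

/-! ### Restrictions of functors to full subcategories -/

/-- The restriction `P ⥤ Q` of a functor `Φ : A ⥤ B` to full subcategories. -/
def restrict {A : Type u₁} [Category.{v₁} A] {B : Type u₂} [Category.{v₂} B]
    (P : ObjectProperty A) (Q : ObjectProperty B) (Φ : A ⥤ B) (h : ∀ X, P X → Q (Φ.obj X)) :
    P.FullSubcategory ⥤ Q.FullSubcategory where
  obj X := ⟨Φ.obj X.obj, h X.obj X.property⟩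
  map f := ObjectProperty.homMk (Φ.map f.hom)

/-- The restriction `Pᵒᵖ ⥤ Q` of a contravariant functor `Φ : Aᵒᵖ ⥤ B` to full subcategories. -/
def restrictOp {A : Type u₁} [Category.{v₁} A] {B : Type u₂} [Category.{v₂} B]
    (P : ObjectProperty A) (Q : ObjectProperty B) (Φ : Aᵒᵖ ⥤ B)
    (h : ∀ X, P X → Q (Φ.obj (op X))) :
    P.FullSubcategoryᵒᵖ ⥤ Q.FullSubcategory where
  obj X := ⟨Φ.obj (op X.unop.obj), h X.unop.obj X.unop.property⟩
  map f := ObjectProperty.homMk (Φ.map f.unop.hom.op)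
  map_id X := ObjectProperty.hom_ext _ (Φ.map_id (op X.unop.obj))
  map_comp f g := ObjectProperty.hom_ext _ (Φ.map_comp f.unop.hom.op g.unop.hom.op)

/-! ### Linear structure on opposite categories -/

instance oppositeLinear (K : Type w) [Field K] (C : Type u) [Category.{v} C] [Preadditive C]
    [Linear K C] : Linear K Cᵒᵖ where
  homModule X Y :=
    { smul := fun r f => (r • f.unop).op
      one_smul := fun f => Quiver.Hom.unop_inj (one_smul K f.unop)
      mul_smul := fun a b f => Quiver.Hom.unop_inj (mul_smul a b f.unop)
      smul_zero := fun a => Quiver.Hom.unop_inj (smul_zero (A := Y.unop ⟶ X.unop) a)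
      smul_add := fun a f g => Quiver.Hom.unop_inj (smul_add a f.unop g.unop)
      add_smul := fun a b f => Quiver.Hom.unop_inj (add_smul a b f.unop)
      zero_smul := fun f => Quiver.Hom.unop_inj (zero_smul K f.unop) }
  smul_comp _ _ _ r f g := Quiver.Hom.unop_inj (Linear.comp_smul _ _ _ g.unop r f.unop)
  comp_smul _ _ _ f r g := Quiver.Hom.unop_inj (Linear.smul_comp _ _ _ r g.unop f.unop)

/-! ### Modules over a `K`-category -/

/-- The property of being a `K`-linear functor `C ⥤ Mod K`. -/
def isLinearFunctor (K : Type w) [Field K] (C : Type u) [Category.{v} C] [Preadditive C]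
    [Linear K C] : ObjectProperty (C ⥤ ModuleCat.{max u v w} K) :=
  fun F => F.Additive ∧ F.Linear K

/-- `Mod(C)`: the category of covariant `K`-linear functors from `C` to `K`-vector spaces. The
vector spaces live in a universe that contains `K`, the objects and the morphisms of `C`, so that
`C` is small with respect to it. -/
abbrev Mod (K : Type w) [Field K] (C : Type u) [Category.{v} C] [Preadditive C] [Linear K C] :=
  (isLinearFunctor K C).FullSubcategory

section Basics

variable {K : Type w} [Field K] {C : Type u} [Category.{v} C] [Preadditive C] [Linear K C]

instance (F : Mod K C) : F.obj.Additive := F.property.1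

instance (F : Mod K C) : F.obj.Linear K := F.property.2

/-- A `C`-module is finitely generated if finitely many elements `x i ∈ M (c i)` generate it, that
is (Yoneda), if it is an epimorphic image of a finite direct sum of functors `C(c i, -)`. -/
def IsFinGen (M : Mod K C) : Prop :=
  ∃ (n : ℕ) (c : Fin n → C) (x : ∀ i, M.obj.obj (c i)),
    ∀ (d : C) (y : M.obj.obj d), ∃ f : ∀ i, c i ⟶ d, y = ∑ i, (M.obj.map (f i)).hom (x i)

/-- A `C`-module `M` is finitely presented if there is an exact sequence `P₁ ⟶ P₀ ⟶ M ⟶ 0` with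
`P₁` and `P₀` finitely generated projective `C`-modules; exactness in `Mod(C)` is objectwise. -/
def IsFinPres (M : Mod K C) : Prop :=
  ∃ (P₁ P₀ : Mod K C) (g : P₁ ⟶ P₀) (f : P₀ ⟶ M),
    IsFinGen P₁ ∧ Projective P₁ ∧ IsFinGen P₀ ∧ Projective P₀ ∧
      ∀ c : C, Function.Exact (g.hom.app c).hom (f.hom.app c).hom ∧
        Function.Surjective (f.hom.app c).hom

end Basics

/-- `mod(C)` as a property of objects of `Mod(C)`. -/
def fp (K : Type w) [Field K] (C : Type u) [Category.{v} C] [Preadditive C] [Linear K C] :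
    ObjectProperty (Mod K C) :=
  fun M => IsFinPres M

/-- The functor `Cᵒᵖ ⥤ Mod K` given by `c ↦ Hom_K(M(c), K)`. -/
@[simps]
def dualFunctor {K : Type w} [Field K] {C : Type u} [Category.{v} C]
    (M : C ⥤ ModuleCat.{max u v w} K) : Cᵒᵖ ⥤ ModuleCat.{max u v w} K where
  obj c := ModuleCat.of K (Module.Dual K (M.obj c.unop))
  map f := ModuleCat.ofHom (M.map f.unop).hom.dualMap
  map_id c := by ext; simp
  map_comp f g := by ext; simp

instance {K : Type w} [Field K] {C : Type u} [Category.{v} C] [Preadditive C]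
    (M : C ⥤ ModuleCat.{max u v w} K) [M.Additive] : (dualFunctor M).Additive where
  map_add {X Y f g} := by
    refine ModuleCat.hom_ext (LinearMap.ext fun (φ : Module.Dual K (M.obj X.unop)) =>
      LinearMap.ext fun x => ?_)
    change φ ((M.map (f.unop + g.unop)).hom x) =
      φ ((M.map f.unop).hom x) + φ ((M.map g.unop).hom x)
    simp

instance {K : Type w} [Field K] {C : Type u} [Category.{v} C] [Preadditive C] [Linear K C]
    (M : C ⥤ ModuleCat.{max u v w} K) [M.Linear K] : (dualFunctor M).Linear K where
  map_smul {X Y} f r := by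
    refine ModuleCat.hom_ext (LinearMap.ext fun (φ : Module.Dual K (M.obj X.unop)) =>
      LinearMap.ext fun x => ?_)
    change φ ((M.map (r • f.unop)).hom x) = r • φ ((M.map f.unop).hom x)
    simp

/-- The (contravariant) functor `D_C : Mod(C) → Mod(Cᵒᵖ)`, `D_C(M)(c) = Hom_K(M(c), K)`. -/
def D (K : Type w) [Field K] (C : Type u) [Category.{v} C] [Preadditive C] [Linear K C] :
    (Mod K C)ᵒᵖ ⥤ Mod K Cᵒᵖ where
  obj M := ⟨dualFunctor M.unop.obj, inferInstance, inferInstance⟩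
  map η := ObjectProperty.homMk
    { app := fun c => ModuleCat.ofHom (η.unop.hom.app c.unop).hom.dualMap
      naturality := fun c d f => by
        refine ModuleCat.hom_ext (LinearMap.ext fun φ => LinearMap.ext fun x => ?_)
        exact congrArg (fun h => φ.toFun (h.hom x)) (η.unop.hom.naturality f.unop).symm }
  map_id M := rfl
  map_comp f g := rfl

/-! ### Dualizing varieties -/

/-- A `Hom`-finite `K`-variety: a skeletally small (with respect to the universe `s`) additive
`K`-category with split idempotents and finite-dimensional spaces of morphisms. -/
structure IsHomFiniteVariety (K : Type w) [Field K] (C : Type u) [Category.{v} C] [Preadditive C]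
    [Linear K C] : Prop where
  essentiallySmall : EssentiallySmall.{s} C
  hasFiniteBiproducts : Limits.HasFiniteBiproducts C
  isIdempotentComplete : IsIdempotentComplete C
  homFinite : ∀ X Y : C, Module.Finite K (X ⟶ Y)

/-- The restriction `mod(C) → mod(Cᵒᵖ)` of `D_C`, given that `D_C` preserves finitely presented
modules. -/
def DRestrict (K : Type w) [Field K] (C : Type u) [Category.{v} C] [Preadditive C] [Linear K C]
    (h : ∀ M : Mod K C, fp K C M → fp K Cᵒᵖ ((D K C).obj (op M))) :
    (fp K C).FullSubcategoryᵒᵖ ⥤ (fp K Cᵒᵖ).FullSubcategory :=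
  restrictOp (fp K C) (fp K Cᵒᵖ) (D K C) h

/-- A dualizing `K`-variety: a `Hom`-finite `K`-variety `C` such that `D_C` restricts to a duality
`mod(C) → mod(Cᵒᵖ)`. -/
structure IsDualizingVariety (K : Type w) [Field K] (C : Type u) [Category.{v} C] [Preadditive C]
    [Linear K C] : Prop extends IsHomFiniteVariety.{s} K C where
  duality : ∃ h : ∀ M : Mod K C, fp K C M → fp K Cᵒᵖ ((D K C).obj (op M)),
    (DRestrict K C h).IsEquivalence

/-! ### The tensor product of `K`-categories -/

/-- The objects of `C ⊗_K E` are pairs of objects. -/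
structure TensorCat (K : Type w) (C : Type u₁) (E : Type u₂) where
  fst : C
  snd : E

section Tensor

variable (K : Type w) [Field K] (C : Type u₁) [Category.{v₁} C] [Preadditive C] [Linear K C]
  (E : Type u₂) [Category.{v₂} E] [Preadditive E] [Linear K E]

/-- The composition `(f₂ ⊗ g₂) ∘ (f₁ ⊗ g₁) = (f₂ ∘ f₁) ⊗ (g₂ ∘ g₁)` of `C ⊗_K E`. -/
def tensorComp (X Y Z : TensorCat K C E) :
    ((X.fst ⟶ Y.fst) ⊗[K] (X.snd ⟶ Y.snd)) →ₗ[K] ((Y.fst ⟶ Z.fst) ⊗[K] (Y.snd ⟶ Z.snd)) →ₗ[K]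
      ((X.fst ⟶ Z.fst) ⊗[K] (X.snd ⟶ Z.snd)) :=
  TensorProduct.map₂ (Linear.comp (S := K) X.fst Y.fst Z.fst)
    (Linear.comp (S := K) X.snd Y.snd Z.snd)

variable {K C E} in
@[simp]
lemma tensorComp_tmul {X Y Z : TensorCat K C E} (f : X.fst ⟶ Y.fst) (g : X.snd ⟶ Y.snd)
    (f' : Y.fst ⟶ Z.fst) (g' : Y.snd ⟶ Z.snd) :
    tensorComp K C E X Y Z (f ⊗ₜ g) (f' ⊗ₜ g') = (f ≫ f') ⊗ₜ (g ≫ g') := by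
  simp [tensorComp, TensorProduct.map₂_apply_tmul]

/-- Morphisms `(c, e) ⟶ (c', e')` are the elements of `C(c, c') ⊗_K E(e, e')`. -/
instance : Category.{max v₁ v₂} (TensorCat K C E) where
  Hom X Y := (X.fst ⟶ Y.fst) ⊗[K] (X.snd ⟶ Y.snd)
  id X := 𝟙 X.fst ⊗ₜ[K] 𝟙 X.snd
  comp {X Y Z} f g := tensorComp K C E X Y Z f g
  id_comp f := by
    induction f using TensorProduct.induction_on with
    | zero => simp
    | tmul a b => simp
    | add a b ha hb => rw [map_add, ha, hb]
  comp_id f := by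
    induction f using TensorProduct.induction_on with
    | zero => simp
    | tmul a b => simp
    | add a b ha hb => rw [map_add, LinearMap.add_apply, ha, hb]
  assoc f g h := by
    induction f using TensorProduct.induction_on with
    | zero => simp
    | add a b ha hb => simp only [map_add, LinearMap.add_apply, ha, hb]
    | tmul a b =>
      induction g using TensorProduct.induction_on with
      | zero => simp
      | add a b ha hb => simp only [map_add, LinearMap.add_apply, ha, hb]
      | tmul c d =>
        induction h using TensorProduct.induction_on with
        | zero => simp
        | add a b ha hb => simp only [map_add, ha, hb]
        | tmul e f => simp

instance (X Y : TensorCat K C E) : AddCommGroup (X ⟶ Y) :=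
  inferInstanceAs (AddCommGroup ((X.fst ⟶ Y.fst) ⊗[K] (X.snd ⟶ Y.snd)))

instance (X Y : TensorCat K C E) : Module K (X ⟶ Y) :=
  inferInstanceAs (Module K ((X.fst ⟶ Y.fst) ⊗[K] (X.snd ⟶ Y.snd)))

instance : Preadditive (TensorCat K C E) where
  add_comp X Y Z f f' g := by
    change tensorComp K C E X Y Z (f + f') g =
      tensorComp K C E X Y Z f g + tensorComp K C E X Y Z f' g
    exact LinearMap.congr_fun (map_add (tensorComp K C E X Y Z) f f') g
  comp_add X Y Z f g g' := map_add (tensorComp K C E X Y Z f) g g'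

instance : Linear K (TensorCat K C E) where
  smul_comp X Y Z r f g := by
    change tensorComp K C E X Y Z (r • f) g = r • tensorComp K C E X Y Z f g
    exact LinearMap.congr_fun ((tensorComp K C E X Y Z).map_smul r f) g
  comp_smul X Y Z f r g := map_smul (tensorComp K C E X Y Z f) r g

variable {K C E}

/-- The morphism `f ⊗ g` of `C ⊗_K E`. -/
def tmul {X Y : TensorCat K C E} (f : X.fst ⟶ Y.fst) (g : X.snd ⟶ Y.snd) : X ⟶ Y :=
  f ⊗ₜ[K] g

lemma tmul_id (X : TensorCat K C E) : tmul (𝟙 X.fst) (𝟙 X.snd) = 𝟙 X := rfl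

lemma tmul_comp {X Y Z : TensorCat K C E} (f : X.fst ⟶ Y.fst) (g : X.snd ⟶ Y.snd)
    (f' : Y.fst ⟶ Z.fst) (g' : Y.snd ⟶ Z.snd) :
    tmul f g ≫ tmul f' g' = tmul (f ≫ f') (g ≫ g') :=
  tensorComp_tmul f g f' g'

lemma add_tmul {X Y : TensorCat K C E} (f f' : X.fst ⟶ Y.fst) (g : X.snd ⟶ Y.snd) :
    tmul (f + f') g = tmul f g + tmul f' g :=
  TensorProduct.add_tmul _ _ _

lemma tmul_add {X Y : TensorCat K C E} (f : X.fst ⟶ Y.fst) (g g' : X.snd ⟶ Y.snd) :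
    tmul f (g + g') = tmul f g + tmul f g' :=
  TensorProduct.tmul_add _ _ _

lemma smul_tmul {X Y : TensorCat K C E} (r : K) (f : X.fst ⟶ Y.fst) (g : X.snd ⟶ Y.snd) :
    tmul (r • f) g = r • tmul f g :=
  rfl

lemma tmul_smul {X Y : TensorCat K C E} (r : K) (f : X.fst ⟶ Y.fst) (g : X.snd ⟶ Y.snd) :
    tmul f (r • g) = r • tmul f g :=
  TensorProduct.tmul_smul _ _ _

end Tensor

section Bimodules

variable {K : Type w} [Field K] {C : Type u} [Category.{v} C] [Preadditive C] [Linear K C]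
  {E : Type u} [Category.{v} E] [Preadditive E] [Linear K E]

/-- For `M ∈ Mod(C ⊗ E)` and `e ∈ E`, the `C`-module `M(-, e)`, with `f` acting as `M(f ⊗ 1)`. -/
def fixSnd (M : Mod K (TensorCat K C E)) (e : E) : Mod K C where
  obj :=
    { obj := fun c => M.obj.obj ⟨c, e⟩
      map := fun {c c'} f => M.obj.map (tmul (X := ⟨c, e⟩) (Y := ⟨c', e⟩) f (𝟙 e))
      map_id := fun c => M.obj.map_id ⟨c, e⟩
      map_comp := fun f g => by
        rw [← Functor.map_comp, tmul_comp, Category.id_comp] }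
  property :=
    ⟨⟨fun {_ _ f g} => by dsimp only; rw [add_tmul, Functor.map_add]⟩,
      ⟨fun f r => by dsimp only; rw [smul_tmul, Functor.map_smul]⟩⟩

/-- For `M ∈ Mod(C ⊗ E)` and `c ∈ C`, the `E`-module `M(c, -)`, with `g` acting as `M(1 ⊗ g)`. -/
def fixFst (M : Mod K (TensorCat K C E)) (c : C) : Mod K E where
  obj :=
    { obj := fun e => M.obj.obj ⟨c, e⟩
      map := fun {e e'} g => M.obj.map (tmul (X := ⟨c, e⟩) (Y := ⟨c, e'⟩) (𝟙 c) g)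
      map_id := fun e => M.obj.map_id ⟨c, e⟩
      map_comp := fun f g => by
        rw [← Functor.map_comp, tmul_comp, Category.id_comp] }
  property :=
    ⟨⟨fun {_ _ f g} => by dsimp only; rw [tmul_add, Functor.map_add]⟩,
      ⟨fun f r => by dsimp only; rw [tmul_smul, Functor.map_smul]⟩⟩

/-- The functor `e ↦ M(-, e)`. -/
def fixSndFunctor (M : Mod K (TensorCat K C E)) : E ⥤ Mod K C where
  obj e := fixSnd M e
  map {e e'} g := ObjectProperty.homMk
    { app := fun c => M.obj.map (tmul (X := ⟨c, e⟩) (Y := ⟨c, e'⟩) (𝟙 c) g)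
      naturality := fun c c' f => by
        dsimp only [fixSnd]
        rw [← Functor.map_comp, ← Functor.map_comp, tmul_comp, tmul_comp]
        simp }
  map_id e := by
    refine ObjectProperty.hom_ext _ (NatTrans.ext (funext fun c => ?_))
    exact M.obj.map_id ⟨c, e⟩
  map_comp {e e' e''} g h := by
    refine ObjectProperty.hom_ext _ (NatTrans.ext (funext fun c => ?_))
    change M.obj.map _ = M.obj.map _ ≫ M.obj.map _
    rw [← Functor.map_comp, tmul_comp, Category.id_comp]

instance (M : Mod K (TensorCat K C E)) : (fixSndFunctor M).Additive where
  map_add {e e' g h} := by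
    refine ObjectProperty.hom_ext _ (NatTrans.ext (funext fun c => ?_))
    change M.obj.map _ = M.obj.map _ + M.obj.map _
    rw [tmul_add, Functor.map_add]
    rfl

instance (M : Mod K (TensorCat K C E)) : (fixSndFunctor M).Linear K where
  map_smul {e e'} g r := by
    refine ObjectProperty.hom_ext _ (NatTrans.ext (funext fun c => ?_))
    change M.obj.map _ = r • M.obj.map _
    rw [tmul_smul, Functor.map_smul]

/-- The linear map `f ⊗ g ↦ g ⊗ f` underlying `swapUnopUnop`. -/
def swapUnopUnopHom {X Y : TensorCat K E Cᵒᵖᵒᵖ} :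
    ((X.fst ⟶ Y.fst) ⊗[K] (X.snd ⟶ Y.snd)) →ₗ[K]
      ((X.snd.unop.unop ⟶ Y.snd.unop.unop) ⊗[K] (X.fst ⟶ Y.fst)) :=
  (TensorProduct.map
    ({ toFun := fun f => f.unop.unop
       map_add' := fun _ _ => rfl
       map_smul' := fun _ _ => rfl } :
      (X.snd ⟶ Y.snd) →ₗ[K] (X.snd.unop.unop ⟶ Y.snd.unop.unop)) LinearMap.id).comp
    (TensorProduct.comm K _ _).toLinearMap

/-- The isomorphism `E ⊗ C ≅ C ⊗ E`, `(e, c) ↦ (c, e)`, where `C` is written as its double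
opposite on the left. -/
def swapUnopUnop : TensorCat K E Cᵒᵖᵒᵖ ⥤ TensorCat K C E where
  obj X := ⟨X.snd.unop.unop, X.fst⟩
  map {X Y} f := swapUnopUnopHom (X := X) (Y := Y) f
  map_id X := rfl
  map_comp {X Y Z} f g := by
    change swapUnopUnopHom (tensorComp K E Cᵒᵖᵒᵖ X Y Z f g) =
      tensorComp K C E ⟨X.snd.unop.unop, X.fst⟩ ⟨Y.snd.unop.unop, Y.fst⟩ ⟨Z.snd.unop.unop, Z.fst⟩
        (swapUnopUnopHom f) (swapUnopUnopHom g)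
    induction f using TensorProduct.induction_on with
    | zero => simp only [map_zero, LinearMap.zero_apply]
    | add a b ha hb => simp only [map_add, LinearMap.add_apply, ha, hb]
    | tmul a b =>
      induction g using TensorProduct.induction_on with
      | zero => simp only [map_zero]
      | add a b ha hb => simp only [map_add, ha, hb]
      | tmul c d =>
        simp only [tensorComp_tmul, swapUnopUnopHom, LinearMap.comp_apply, LinearEquiv.coe_coe,
          TensorProduct.comm_tmul, TensorProduct.map_tmul, LinearMap.id_apply]
        exact (tensorComp_tmul (K := K) (X := ⟨X.snd.unop.unop, X.fst⟩)
          (Y := ⟨Y.snd.unop.unop, Y.fst⟩) (Z := ⟨Z.snd.unop.unop, Z.fst⟩)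
          b.unop.unop a d.unop.unop c).symm

/-- For `M ∈ Mod(C ⊗ E)`, the module `M̄ ∈ Mod(E ⊗ C)`, `M̄(e, c) = M(c, e)`,
`M̄(g ⊗ f) = M(f ⊗ g)`, where `C` is written as its double opposite. -/
def bar (M : Mod K (TensorCat K C E)) : Mod K (TensorCat K E Cᵒᵖᵒᵖ) where
  obj := swapUnopUnop ⋙ M.obj
  property :=
    ⟨⟨fun {X Y f g} => by
        dsimp only [Functor.comp_map, swapUnopUnop]
        exact (congrArg M.obj.map (map_add swapUnopUnopHom f g)).trans M.obj.map_add⟩,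
      ⟨fun {X Y} f r => by
        dsimp only [Functor.comp_map, swapUnopUnop]
        exact (congrArg M.obj.map (map_smul swapUnopUnopHom r f)).trans (M.obj.map_smul r _)⟩⟩

end Bimodules

section Triangular

variable {K : Type w} [Field K] {U : Type u} [Category.{v} U] [Preadditive U] [Linear K U]
  {T : Type u} [Category.{v} T] [Preadditive T] [Linear K T]

/-! ### The functor `G` and the comma category -/

/-- The functor `G : Mod(U) → Mod(T)`, `G(B)(t) = Hom_{Mod(U)}(M(-, t), B)`. -/
def G (M : Mod K (TensorCat K U Tᵒᵖ)) : Mod K U ⥤ Mod K T where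
  obj B :=
    { obj :=
        { obj := fun t => ModuleCat.of K ((fixSndFunctor M).obj (op t) ⟶ B)
          map := fun f => ModuleCat.ofHom (Linear.leftComp K B ((fixSndFunctor M).map f.op))
          map_id := fun t => by
            ext φ
            simp
          map_comp := fun f g => by
            ext φ
            simp }
      property :=
        ⟨⟨fun {t t' f g} => by
            ext φ
            simp⟩,
          ⟨fun {t t'} f r => by
            refine ModuleCat.hom_ext (LinearMap.ext fun φ => ?_)
            change (fixSndFunctor M).map (r • f.op) ≫ φ = r • ((fixSndFunctor M).map f.op ≫ φ)
            rw [Functor.map_smul, Linear.smul_comp]⟩⟩ }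
  map β := ObjectProperty.homMk
    { app := fun t => ModuleCat.ofHom (Linear.rightComp K ((fixSndFunctor M).obj (op t)) β)
      naturality := fun t t' f => by
        ext φ
        simp }
  map_id B := by
    refine ObjectProperty.hom_ext _ (NatTrans.ext (funext fun c => ?_))
    ext φ
    simp
  map_comp β γ := by
    refine ObjectProperty.hom_ext _ (NatTrans.ext (funext fun c => ?_))
    ext φ
    simp

/-- The comma category `(Mod(T), G Mod(U))` of triples `(A, f : A ⟶ G(B), B)`. -/
abbrev CommaMod (M : Mod K (TensorCat K U Tᵒᵖ)) := Comma (𝟭 (Mod K T)) (G M)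

/-- The full subcategory `(mod(T), G mod(U))` of the triples `(A, f, B)` with `A` and `B` finitely
presented. -/
def commaFp (M : Mod K (TensorCat K U Tᵒᵖ)) : ObjectProperty (CommaMod M) :=
  fun X => fp K T X.left ∧ fp K U X.right

/-- For `f : A ⟶ G(B)`, `m ∈ M(u, t)` and `x ∈ A(t)`, the element `m · x = [f_t(x)]_u(m)` of
`B(u)`, as a bilinear map. -/
def dot {M : Mod K (TensorCat K U Tᵒᵖ)} (X : CommaMod M) (u : U) (t : T) :
    M.obj.obj ⟨u, op t⟩ →ₗ[K] X.left.obj.obj t →ₗ[K] X.right.obj.obj u :=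
  LinearMap.mk₂ K
    (fun m x => (((X.hom.hom.app t).hom x : (fixSndFunctor M).obj (op t) ⟶ X.right).hom.app u).hom m)
    (fun m m' x => map_add _ m m') (fun r m x => map_smul _ r m)
    (fun m x x' => by rw [map_add]; rfl) (fun r m x => by rw [map_smul]; rfl)

/-! ### The triangular matrix category -/

/-- Objects of `Λ = [[T, 0], [M, U]]`: matrices `[[t, 0], [M, u]]`. -/
structure Tri (M : Mod K (TensorCat K U Tᵒᵖ)) where
  t : T
  u : U

/-- Morphisms of `Λ`: matrices `[[t, 0], [m, u]]` with `m ∈ M(u', t)`. -/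
@[ext]
structure TriHom {M : Mod K (TensorCat K U Tᵒᵖ)} (X Y : Tri M) where
  t : X.t ⟶ Y.t
  m : M.obj.obj ⟨Y.u, op X.t⟩
  u : X.u ⟶ Y.u

/-- `m • t = M(1 ⊗ tᵒᵖ)(m)`. -/
def actRight (M : Mod K (TensorCat K U Tᵒᵖ)) {u : U} {t t' : T} (f : t ⟶ t') :
    M.obj.obj ⟨u, op t'⟩ →ₗ[K] M.obj.obj ⟨u, op t⟩ :=
  ((fixFst M u).obj.map f.op).hom

/-- `u • m = M(u ⊗ 1)(m)`. -/
def actLeft (M : Mod K (TensorCat K U Tᵒᵖ)) {u u' : U} {t : T} (g : u ⟶ u') :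
    M.obj.obj ⟨u, op t⟩ →ₗ[K] M.obj.obj ⟨u', op t⟩ :=
  ((fixSnd M (op t)).obj.map g).hom

section Act

variable (M : Mod K (TensorCat K U Tᵒᵖ)) {u u' u'' : U} {t t' t'' : T}

@[simp] lemma actRight_id (m : M.obj.obj ⟨u, op t⟩) : actRight M (𝟙 t) m = m :=
  congrArg (fun h => h.hom m) ((fixFst M u).obj.map_id (op t))

@[simp] lemma actLeft_id (m : M.obj.obj ⟨u, op t⟩) : actLeft M (𝟙 u) m = m :=
  congrArg (fun h => h.hom m) ((fixSnd M (op t)).obj.map_id u)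

lemma actRight_comp (f : t ⟶ t') (g : t' ⟶ t'') (m : M.obj.obj ⟨u, op t''⟩) :
    actRight M (f ≫ g) m = actRight M f (actRight M g m) :=
  congrArg (fun h => h.hom m) ((fixFst M u).obj.map_comp g.op f.op)

lemma actLeft_comp (f : u ⟶ u') (g : u' ⟶ u'') (m : M.obj.obj ⟨u, op t⟩) :
    actLeft M (f ≫ g) m = actLeft M g (actLeft M f m) :=
  congrArg (fun h => h.hom m) ((fixSnd M (op t)).obj.map_comp f g)

lemma actRight_add (f g : t ⟶ t') (m : M.obj.obj ⟨u, op t'⟩) :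
    actRight M (f + g) m = actRight M f m + actRight M g m :=
  congrArg (fun h => h.hom m) ((fixFst M u).obj.map_add (f := f.op) (g := g.op))

lemma actLeft_add (f g : u ⟶ u') (m : M.obj.obj ⟨u, op t⟩) :
    actLeft M (f + g) m = actLeft M f m + actLeft M g m :=
  congrArg (fun h => h.hom m) ((fixSnd M (op t)).obj.map_add (f := f) (g := g))

lemma actRight_smul (r : K) (f : t ⟶ t') (m : M.obj.obj ⟨u, op t'⟩) :
    actRight M (r • f) m = r • actRight M f m :=
  congrArg (fun h => h.hom m) ((fixFst M u).obj.map_smul r f.op)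

lemma actLeft_smul (r : K) (f : u ⟶ u') (m : M.obj.obj ⟨u, op t⟩) :
    actLeft M (r • f) m = r • actLeft M f m :=
  congrArg (fun h => h.hom m) ((fixSnd M (op t)).obj.map_smul r f)

lemma actLeft_actRight (f : t ⟶ t') (g : u ⟶ u') (m : M.obj.obj ⟨u, op t'⟩) :
    actLeft M g (actRight M f m) = actRight M f (actLeft M g m) :=
  congrArg (fun h => h.hom m) (((fixSndFunctor M).map f.op).hom.naturality g).symm

end Act

variable {M : Mod K (TensorCat K U Tᵒᵖ)}

/-- Composition is matrix multiplication:
`[[t₂, 0], [m₂, u₂]] ∘ [[t₁, 0], [m₁, u₁]] = [[t₂ ∘ t₁, 0], [m₂ • t₁ + u₂ • m₁, u₂ ∘ u₁]]`. -/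
instance : Category.{max u v w} (Tri M) where
  Hom X Y := TriHom X Y
  id X := ⟨𝟙 X.t, 0, 𝟙 X.u⟩
  comp f g := ⟨f.t ≫ g.t, actRight M f.t g.m + actLeft M g.u f.m, f.u ≫ g.u⟩
  id_comp f := by ext <;> simp
  comp_id f := by ext <;> simp
  assoc f g h := by
    ext
    · simp
    · simp [actRight_comp, actLeft_comp, actLeft_actRight, add_assoc]
    · simp

namespace Tri

@[ext] lemma hom_ext {X Y : Tri M} {f g : X ⟶ Y} (ht : f.t = g.t) (hm : f.m = g.m)
    (hu : f.u = g.u) : f = g :=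
  TriHom.ext ht hm hu

@[simp] lemma id_t (X : Tri M) : TriHom.t (𝟙 X) = 𝟙 X.t := rfl
@[simp] lemma id_m (X : Tri M) : TriHom.m (𝟙 X) = 0 := rfl
@[simp] lemma id_u (X : Tri M) : TriHom.u (𝟙 X) = 𝟙 X.u := rfl
@[simp] lemma comp_t {X Y Z : Tri M} (f : X ⟶ Y) (g : Y ⟶ Z) : (f ≫ g).t = f.t ≫ g.t := rfl
@[simp] lemma comp_m {X Y Z : Tri M} (f : X ⟶ Y) (g : Y ⟶ Z) :
    (f ≫ g).m = actRight M f.t g.m + actLeft M g.u f.m := rfl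
@[simp] lemma comp_u {X Y Z : Tri M} (f : X ⟶ Y) (g : Y ⟶ Z) : (f ≫ g).u = f.u ≫ g.u := rfl

/-- A morphism of `Λ` is a triple; addition and scalar multiplication are entrywise. -/
def homEquiv (X Y : Tri M) :
    (X ⟶ Y) ≃ (X.t ⟶ Y.t) × M.obj.obj ⟨Y.u, op X.t⟩ × (X.u ⟶ Y.u) where
  toFun f := (f.t, f.m, f.u)
  invFun p := ⟨p.1, p.2.1, p.2.2⟩
  left_inv _ := rfl
  right_inv _ := rfl

instance (X Y : Tri M) : AddCommGroup (X ⟶ Y) := (homEquiv X Y).addCommGroup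

instance (X Y : Tri M) : Module K (X ⟶ Y) := (homEquiv X Y).module K

@[simp] lemma add_t {X Y : Tri M} (f g : X ⟶ Y) : (f + g).t = f.t + g.t := rfl
@[simp] lemma add_m {X Y : Tri M} (f g : X ⟶ Y) : (f + g).m = f.m + g.m := rfl
@[simp] lemma add_u {X Y : Tri M} (f g : X ⟶ Y) : (f + g).u = f.u + g.u := rfl
@[simp] lemma smul_t {X Y : Tri M} (r : K) (f : X ⟶ Y) : (r • f).t = r • f.t := rfl
@[simp] lemma smul_m {X Y : Tri M} (r : K) (f : X ⟶ Y) : (r • f).m = r • f.m := rfl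
@[simp] lemma smul_u {X Y : Tri M} (r : K) (f : X ⟶ Y) : (r • f).u = r • f.u := rfl

instance : Preadditive (Tri M) where
  add_comp X Y Z f f' g := by
    ext
    · simp
    · simp only [comp_m, add_t, add_m, map_add, actRight_add]
      abel
    · simp
  comp_add X Y Z f g g' := by
    ext
    · simp
    · simp only [comp_m, add_u, add_m, map_add, actLeft_add]
      abel
    · simp

instance : Linear K (Tri M) where
  smul_comp X Y Z r f g := by
    ext
    · simp
    · simp only [comp_m, smul_t, smul_m, map_smul, actRight_smul, smul_add]
    · simp
  comp_smul X Y Z f r g := by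
    ext
    · simp
    · simp only [comp_m, smul_u, smul_m, map_smul, actLeft_smul, smul_add]
    · simp

end Tri

/-! ### The functor `F` from the comma category to `Mod(Λ)` -/

lemma dot_actLeft (X : CommaMod M) {u u' : U} {t : T} (g : u ⟶ u') (m : M.obj.obj ⟨u, op t⟩)
    (x : X.left.obj.obj t) :
    dot X u' t (actLeft M g m) x = (X.right.obj.map g).hom (dot X u t m x) :=
  congrArg (fun h => h.hom m)
    (((X.hom.hom.app t).hom x : (fixSndFunctor M).obj (op t) ⟶ X.right).hom.naturality g)

lemma dot_actRight (X : CommaMod M) {u : U} {t t' : T} (f : t ⟶ t') (m : M.obj.obj ⟨u, op t'⟩)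
    (x : X.left.obj.obj t) :
    dot X u t (actRight M f m) x = dot X u t' m ((X.left.obj.map f).hom x) :=
  congrArg (fun h : (fixSndFunctor M).obj (op t') ⟶ X.right => (h.hom.app u).hom m)
    (congrArg (fun h => h.hom x) (X.hom.hom.naturality f)).symm

lemma dot_naturality {X Y : CommaMod M} (α : X ⟶ Y) {u : U} {t : T} (m : M.obj.obj ⟨u, op t⟩)
    (x : X.left.obj.obj t) :
    (α.right.hom.app u).hom (dot X u t m x) = dot Y u t m ((α.left.hom.app t).hom x) :=
  congrArg (fun h : (fixSndFunctor M).obj (op t) ⟶ Y.right => (h.hom.app u).hom m)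
    (congrArg (fun h => (h.hom.app t).hom x) α.w).symm

/-- The action of the matrix `[[t, 0], [m, u]]` on `A(t) × B(u)`:
`(x, y) ↦ (A(t)(x), m · x + B(u)(y))`. -/
def coprodMap (X : CommaMod M) {P Q : Tri M} (f : P ⟶ Q) :
    (X.left.obj.obj P.t × X.right.obj.obj P.u) →ₗ[K]
      (X.left.obj.obj Q.t × X.right.obj.obj Q.u) :=
  LinearMap.prod ((X.left.obj.map f.t).hom.comp (LinearMap.fst K _ _))
    ((dot X Q.u P.t f.m).comp (LinearMap.fst K _ _) +
      (X.right.obj.map f.u).hom.comp (LinearMap.snd K _ _))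

lemma coprodMap_apply (X : CommaMod M) {P Q : Tri M} (f : P ⟶ Q) (x : X.left.obj.obj P.t)
    (y : X.right.obj.obj P.u) :
    coprodMap X f (x, y) =
      ((X.left.obj.map f.t).hom x, dot X Q.u P.t f.m x + (X.right.obj.map f.u).hom y) :=
  rfl

/-- The `Λ`-module `A ⨿_f B` attached to `(A, f, B)`. -/
def coprodObj (X : CommaMod M) : Mod K (Tri M) where
  obj :=
    { obj := fun P => ModuleCat.of K (X.left.obj.obj P.t × X.right.obj.obj P.u)
      map := fun f => ModuleCat.ofHom (coprodMap X f)
      map_id := fun P => by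
        refine ModuleCat.hom_ext (LinearMap.ext fun p => ?_)
        obtain ⟨x, y⟩ := p
        change coprodMap X (𝟙 P) (x, y) = (x, y)
        rw [coprodMap_apply]
        simp
      map_comp := fun {P Q R} f g => by
        refine ModuleCat.hom_ext (LinearMap.ext fun p => ?_)
        obtain ⟨x, y⟩ := p
        change coprodMap X (f ≫ g) (x, y) = coprodMap X g (coprodMap X f (x, y))
        simp only [coprodMap_apply, Tri.comp_t, Tri.comp_m, Tri.comp_u, map_add,
          LinearMap.add_apply, dot_actLeft, dot_actRight, Functor.map_comp, ModuleCat.hom_comp,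
          LinearMap.comp_apply, add_assoc] }
  property :=
    ⟨⟨fun {P Q f g} => by
        refine ModuleCat.hom_ext (LinearMap.ext fun p => ?_)
        obtain ⟨x, y⟩ := p
        change coprodMap X (f + g) (x, y) = coprodMap X f (x, y) + coprodMap X g (x, y)
        simp only [coprodMap_apply, Tri.add_t, Tri.add_m, Tri.add_u, map_add,
          LinearMap.add_apply, Functor.map_add, ModuleCat.hom_add, Prod.mk_add_mk]
        congr 1
        abel⟩,
      ⟨fun {P Q} f r => by
        refine ModuleCat.hom_ext (LinearMap.ext fun p => ?_)
        obtain ⟨x, y⟩ := p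
        change coprodMap X (r • f) (x, y) = r • coprodMap X f (x, y)
        simp only [coprodMap_apply, Tri.smul_t, Tri.smul_m, Tri.smul_u, map_smul,
          LinearMap.smul_apply, Functor.map_smul, ModuleCat.hom_smul, Prod.smul_mk, smul_add]⟩⟩

variable (M) in
/-- The functor `F : (Mod(T), G Mod(U)) → Mod(Λ)`, `(A, f, B) ↦ A ⨿_f B`, `(α, β) ↦ α ⨿ β`. -/
def F : CommaMod M ⥤ Mod K (Tri M) where
  obj X := coprodObj X
  map {X Y} α := ObjectProperty.homMk
    { app := fun P => ModuleCat.ofHom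
        (LinearMap.prodMap (α.left.hom.app P.t).hom (α.right.hom.app P.u).hom)
      naturality := fun P Q f => by
        refine ModuleCat.hom_ext (LinearMap.ext fun p => ?_)
        obtain ⟨x, y⟩ := p
        change LinearMap.prodMap (α.left.hom.app Q.t).hom (α.right.hom.app Q.u).hom
            (coprodMap X f (x, y)) =
          coprodMap Y f ((α.left.hom.app P.t).hom x, (α.right.hom.app P.u).hom y)
        have h₁ := congrArg (fun h => h.hom x) (α.left.hom.naturality f.t)
        have h₂ := congrArg (fun h => h.hom y) (α.right.hom.naturality f.u)
        simp only [ModuleCat.hom_comp, LinearMap.comp_apply] at h₁ h₂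
        simp only [coprodMap_apply, LinearMap.prodMap_apply, map_add, dot_naturality, h₂]
        exact Prod.ext h₁ rfl }
  map_id X := rfl
  map_comp α β := rfl

/-! ### The functor `Θ` between the comma categories -/

variable (M) in
/-- The functor `Ḡ : Mod(Tᵒᵖ) → Mod(Uᵒᵖ)`, `Ḡ(A)(u) = Hom_{Mod(Tᵒᵖ)}(M(u, -), A)`: it is the
functor `G` attached to `M̄`. -/
abbrev Gbar : Mod K Tᵒᵖ ⥤ Mod K Uᵒᵖ := G (bar M)

/-- For `s : B(u) → K`, the map `M(u, t) → Hom_K(Hom(M(-, t), B), K)`, `m ↦ (η ↦ s(η_u(m)))`. -/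
def evalDual (B : Mod K U) (u : U) (t : T) (σ : Module.Dual K (B.obj.obj u)) :
    M.obj.obj ⟨u, op t⟩ →ₗ[K] Module.Dual K ((fixSndFunctor M).obj (op t) ⟶ B) :=
  LinearMap.mk₂ K (fun m η => σ ((η.hom.app u).hom m))
    (fun m m' η => map_add (σ.comp (η.hom.app u).hom) m m')
    (fun r m η => map_smul (σ.comp (η.hom.app u).hom) r m)
    (fun _ _ _ => map_add σ _ _)
    (fun r _ _ => map_smul σ r _)

/-- The morphism of `Tᵒᵖ`-modules `M(u, -) → D_T(G(B))` given by `s : B(u) → K`. -/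
def evalDualHom (B : Mod K U) (u : U) (σ : Module.Dual K (B.obj.obj u)) :
    (fixSndFunctor (bar M)).obj (op (op u)) ⟶ (D K T).obj (op ((G M).obj B)) :=
  ObjectProperty.homMk
    { app := fun t => ModuleCat.ofHom (evalDual B u t.unop σ)
      naturality := fun t t' f => by
        refine ModuleCat.hom_ext (LinearMap.ext fun (m : M.obj.obj ⟨u, t⟩) => ?_)
        refine LinearMap.ext fun (η : (fixSndFunctor M).obj t' ⟶ B) => ?_
        rfl }

variable (M) in
/-- The natural map `Ψ_B : D_U(B) → Ḡ(D_T(G(B)))` sending `s : B(u) → K` to the morphism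
`M(u, -) → D_T(G(B))` above. -/
def Psi (B : Mod K U) :
    (D K U).obj (op B) ⟶ (Gbar M).obj ((D K T).obj (op ((G M).obj B))) :=
  ObjectProperty.homMk
    { app := fun u => ModuleCat.ofHom
        { toFun := fun σ => evalDualHom B u.unop σ
          map_add' := fun σ σ' => rfl
          map_smul' := fun r σ => rfl }
      naturality := fun u u' g => by
        refine ModuleCat.hom_ext (LinearMap.ext fun σ => ?_)
        refine ObjectProperty.hom_ext _ (NatTrans.ext (funext fun t => ?_))
        refine ModuleCat.hom_ext (LinearMap.ext fun (m : M.obj.obj ⟨u'.unop, t⟩) => ?_)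
        refine LinearMap.ext fun (η : (fixSndFunctor M).obj t ⟶ B) => ?_
        exact congrArg (fun h => σ.toFun (h.hom m)) (η.hom.naturality g.unop).symm }

/-- The object `Θ(A, f, B)`: the composition `D_U(B) ⟶ Ḡ(D_T(G(B))) ⟶ Ḡ(D_T(A))` of `Ψ_B` and
`Ḡ(D_T(f))`. -/
def ThetaObj (X : CommaMod M) : CommaMod (bar M) where
  left := (D K U).obj (op X.right)
  right := (D K T).obj (op X.left)
  hom := Psi M X.right ≫ (Gbar M).map ((D K T).map X.hom.op)

/-- The morphism `Θ(α, β) = (D_U(β), D_T(α))`. -/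
def ThetaMap {X Y : CommaMod M} (α : X ⟶ Y) : ThetaObj Y ⟶ ThetaObj X where
  left := (D K U).map α.right.op
  right := (D K T).map α.left.op
  w := by
    refine ObjectProperty.hom_ext _ (NatTrans.ext (funext fun u => ?_))
    refine ModuleCat.hom_ext (LinearMap.ext fun (σ : Module.Dual K (Y.right.obj.obj u.unop)) => ?_)
    refine ObjectProperty.hom_ext _ (NatTrans.ext (funext fun t => ?_))
    refine ModuleCat.hom_ext (LinearMap.ext fun (m : M.obj.obj ⟨u.unop, t⟩) => ?_)
    refine LinearMap.ext fun (x : X.left.obj.obj t.unop) => ?_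
    exact congrArg (fun y => σ.toFun y) (dot_naturality α m x)

variable (M) in
/-- The contravariant functor `Θ : (Mod(T), G Mod(U)) → (Mod(Uᵒᵖ), Ḡ Mod(Tᵒᵖ))`. -/
def Theta : (CommaMod M)ᵒᵖ ⥤ CommaMod (bar M) where
  obj X := ThetaObj X.unop
  map α := ThetaMap α.unop
  map_id _ := rfl
  map_comp _ _ := rfl

/-! ### The isomorphism `Λᵒᵖ ≅ Λ̄` -/

variable (M) in
/-- The isomorphism from `Λᵒᵖ` to `Λ̄ = [[Uᵒᵖ, 0], [M̄, Tᵒᵖ]]`, `[[t, 0], [m, u]] ↦ [[u, 0], [m, t]]`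
on morphisms. -/
def toBar : (Tri M)ᵒᵖ ⥤ Tri (bar M) where
  obj X := ⟨op X.unop.u, op X.unop.t⟩
  map f := ⟨f.unop.u.op, f.unop.m, f.unop.t.op⟩
  map_id _ := rfl
  map_comp f g := TriHom.ext rfl
    (add_comm (actRight M g.unop.t f.unop.m) (actLeft M f.unop.u g.unop.m)) rfl

instance : (toBar M).Additive where
  map_add := rfl

instance : (toBar M).Linear K where
  map_smul _ _ := rfl

variable (M) in
/-- The functor `T* : Mod(Λ̄) → Mod(Λᵒᵖ)`, composition with `Λᵒᵖ ≅ Λ̄`. -/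
def Tstar : Mod K (Tri (bar M)) ⥤ Mod K (Tri M)ᵒᵖ where
  obj N := ⟨toBar M ⋙ N.obj, inferInstance, inferInstance⟩
  map η := ObjectProperty.homMk (Functor.whiskerLeft (toBar M) η.hom)
  map_id _ := rfl
  map_comp _ _ := rfl

/-! ### Restrictions to finitely presented modules -/

/-- The restriction of `F` to `(mod(T), G mod(U)) → mod(Λ)`. -/
def FRestrict (h : ∀ X : CommaMod M, commaFp M X → fp K (Tri M) ((F M).obj X)) :
    (commaFp M).FullSubcategory ⥤ (fp K (Tri M)).FullSubcategory :=
  restrict (commaFp M) (fp K (Tri M)) (F M) h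

/-- The restriction of `Θ` to `(mod(T), G mod(U)) → (mod(Uᵒᵖ), Ḡ mod(Tᵒᵖ))`. -/
def ThetaRestrict
    (h : ∀ X : CommaMod M, commaFp M X → commaFp (bar M) ((Theta M).obj (op X))) :
    (commaFp M).FullSubcategoryᵒᵖ ⥤ (commaFp (bar M)).FullSubcategory :=
  restrictOp (commaFp M) (commaFp (bar M)) (Theta M) h

/-- The restriction of `T* ∘ F̄` to `(mod(Uᵒᵖ), Ḡ mod(Tᵒᵖ)) → mod(Λᵒᵖ)`, where `F̄` is the functor
`F` attached to `M̄`. -/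
def TstarFbarRestrict
    (h : ∀ Y : CommaMod (bar M), commaFp (bar M) Y →
      fp K (Tri M)ᵒᵖ ((Tstar M).obj ((F (bar M)).obj Y))) :
    (commaFp (bar M)).FullSubcategory ⥤ (fp K (Tri M)ᵒᵖ).FullSubcategory :=
  restrict (commaFp (bar M)) (fp K (Tri M)ᵒᵖ) (F (bar M) ⋙ Tstar M) h

end Triangular

end

end TriangularMatrix

/-!
Over an additive `K`-category `C`, a module is finitely presented exactly when it is the cokernel of
a map `C(d, -) → C(c, -)`, that is, when it has one generator `x ∈ N(c)` all of whose relations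
factor through one morphism `r : c ⟶ d` (`isFinPres_iff`). With this description the statements
about finite presentation become computations with matrices.

* If `A` and `B` are finitely presented, so is `A ⨿_f B` (`hasPresentation_F`): a generator of `A`
  and one of `B` together generate it, and a generator of `M(-, c)` supplies the one relation that
  connects them.
* Every `Λ`-module `N` is `A ⨿_f B` with `A = N(-, 0)` and `B = N(0, -)` (`isoFToTriple`), and `A`
  and `B` are finitely presented if `N` is (`hasPresentation_restrictT`,
  `hasPresentation_restrictU`).
* On every triple `(A, f, B)`, the isomorphism `B(u)* × A(t)* ≅ (A(t) × B(u))*` is `Λᵒᵖ`-linear and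
  natural; this is `ν` (`nu`).

Hence the dual of a finitely presented `Λ`-module is `T*(D(B) ⨿ D(A))`, and it is finitely presented
because `D(A)` and `D(B)` are (`dualPreserves_tri`). The same applies to `Λ̄ ≅ Λᵒᵖ`, since
duality also preserves finite presentation over the opposite of a dualizing variety
(`IsDualizingVariety.dualPreserves_op`). Finitely presented modules have finite-dimensional values,
on which duality is fully faithful and involutive. As it preserves finite presentation over both
`Λ` and `Λᵒᵖ`, it is an equivalence (`isEquivalence_DRestrict`). The remaining properties of a
`Hom`-finite variety are checked on matrices (`Tri.isHomFiniteVariety`).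
-/

namespace TriangularMatrix

/-! ### Finite presentations by elements -/

section Elements

variable {K : Type w} [Field K] {C : Type u₁} [Category.{v₁} C]

lemma map_comp_apply (N : C ⥤ ModuleCat.{u₂} K) {c d e : C} (f : c ⟶ d) (g : d ⟶ e)
    (x : N.obj c) : (N.map (f ≫ g)).hom x = (N.map g).hom ((N.map f).hom x) := by
  rw [N.map_comp]; rfl

lemma map_id_apply (N : C ⥤ ModuleCat.{u₂} K) {c : C} (x : N.obj c) :
    (N.map (𝟙 c)).hom x = x := by
  rw [N.map_id]; rfl

lemma naturality_apply {N N' : C ⥤ ModuleCat.{u₂} K} (η : N ⟶ N') {c d : C} (f : c ⟶ d)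
    (x : N.obj c) :
    (η.app d).hom ((N.map f).hom x) = (N'.map f).hom ((η.app c).hom x) :=
  congrArg (fun h => h.hom x) (η.naturality f)

section Preadditive

variable [Preadditive C] (N : C ⥤ ModuleCat.{u₂} K) [N.Additive]

lemma map_add_apply {c d : C} (f g : c ⟶ d) (x : N.obj c) :
    (N.map (f + g)).hom x = (N.map f).hom x + (N.map g).hom x := by
  rw [N.map_add]; rfl

lemma map_sub_apply {c d : C} (f g : c ⟶ d) (x : N.obj c) :
    (N.map (f - g)).hom x = (N.map f).hom x - (N.map g).hom x := by
  rw [N.map_sub]; rfl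

lemma map_neg_apply {c d : C} (f : c ⟶ d) (x : N.obj c) :
    (N.map (-f)).hom x = -(N.map f).hom x := by
  rw [N.map_neg]; rfl

lemma map_zero_apply {c d : C} (x : N.obj c) : (N.map (0 : c ⟶ d)).hom x = 0 := by
  rw [N.map_zero]; rfl

/-- Elements of `N (d₁ ⊞ d₂)` are determined by their two projections. -/
lemma biprod_element_ext [Limits.HasBinaryBiproducts C] {d₁ d₂ : C} {x y : N.obj (d₁ ⊞ d₂)}
    (h₁ : (N.map Limits.biprod.fst).hom x = (N.map Limits.biprod.fst).hom y)
    (h₂ : (N.map Limits.biprod.snd).hom x = (N.map Limits.biprod.snd).hom y) : x = y := by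
  rw [← map_id_apply N x, ← map_id_apply N y, ← Limits.biprod.total, map_add_apply, map_add_apply,
    map_comp_apply, map_comp_apply, map_comp_apply, map_comp_apply, h₁, h₂]

end Preadditive

/-- The element `x ∈ N(c)` generates `N`: the map `C(c, -) → N` given by `x` is surjective. -/
def Generates (N : C ⥤ ModuleCat.{u₂} K) {c : C} (x : N.obj c) : Prop :=
  ∀ (e : C) (y : N.obj e), ∃ f : c ⟶ e, (N.map f).hom x = y

/-- The sequence `C(d, -) → C(c, -) → N → 0` given by the relation `r : c ⟶ d` and the generator
`x ∈ N(c)` is exact. -/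
structure Presents [Preadditive C] (N : C ⥤ ModuleCat.{u₂} K) {c d : C} (r : c ⟶ d)
    (x : N.obj c) : Prop where
  relation : (N.map r).hom x = 0
  generates : Generates N x
  exact : ∀ ⦃e : C⦄ (f : c ⟶ e), (N.map f).hom x = 0 → ∃ g : d ⟶ e, r ≫ g = f

/-- The functor `N` is the cokernel of a map `C(d, -) → C(c, -)`. -/
def HasPresentation [Preadditive C] (N : C ⥤ ModuleCat.{u₂} K) : Prop :=
  ∃ (c d : C) (r : c ⟶ d) (x : N.obj c), Presents N r x

lemma HasPresentation.of_iso [Preadditive C] {N N' : C ⥤ ModuleCat.{u₂} K} (e : N ≅ N')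
    (h : HasPresentation N) : HasPresentation N' := by
  obtain ⟨c, d, r, x, hx⟩ := h
  have hinv : ∀ (a : C) (y : N.obj a), (e.inv.app a).hom ((e.hom.app a).hom y) = y := fun a y =>
    congrArg (fun h => h.hom y) (e.hom_inv_id_app a)
  have hhom : ∀ (a : C) (y : N'.obj a), (e.hom.app a).hom ((e.inv.app a).hom y) = y := fun a y =>
    congrArg (fun h => h.hom y) (e.inv_hom_id_app a)
  refine ⟨c, d, r, (e.hom.app c).hom x, ?_, fun a y => ?_, fun a f hf => ?_⟩
  · rw [← naturality_apply, hx.relation, map_zero]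
  · obtain ⟨f, hf⟩ := hx.generates a ((e.inv.app a).hom y)
    exact ⟨f, by rw [← naturality_apply, hf, hhom]⟩
  · refine hx.exact f ?_
    rw [← hinv a ((N.map f).hom x), naturality_apply, hf, map_zero]

/-- Restriction along an equivalence of categories preserves presentations. -/
lemma HasPresentation.comp [Preadditive C] {C' : Type*} [Category* C'] [Preadditive C']
    (Φ : C ⥤ C') [Φ.Full] [Φ.Faithful] [Φ.EssSurj] {N : C' ⥤ ModuleCat.{u₂} K}
    (h : HasPresentation N) : HasPresentation (Φ ⋙ N) := by
  obtain ⟨c, d, r, x, hx⟩ := h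
  let i := Φ.objObjPreimageIso c
  let j := Φ.objObjPreimageIso d
  refine ⟨Φ.objPreimage c, Φ.objPreimage d, Φ.preimage (i.hom ≫ r ≫ j.inv),
    (N.map i.inv).hom x, ?_, fun a y => ?_, fun a f hf => ?_⟩
  · rw [Functor.comp_map, Functor.map_preimage, ← map_comp_apply, Iso.inv_hom_id_assoc,
      map_comp_apply, hx.relation, map_zero]
  · obtain ⟨f, hf⟩ := hx.generates (Φ.obj a) y
    refine ⟨Φ.preimage (i.hom ≫ f), ?_⟩
    rw [Functor.comp_map, Functor.map_preimage, ← map_comp_apply, Iso.inv_hom_id_assoc, hf]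
  · rw [Functor.comp_map, ← map_comp_apply] at hf
    obtain ⟨g, hg⟩ := hx.exact _ hf
    refine ⟨Φ.preimage (j.hom ≫ g), Φ.map_injective ?_⟩
    simp [hg]

/-- Values of a functor with a generator are finite-dimensional if the spaces of morphisms are. -/
lemma Generates.finite [Preadditive C] [Linear K C] (hC : ∀ X Y : C, Module.Finite K (X ⟶ Y))
    {N : C ⥤ ModuleCat.{u₂} K} [N.Additive] [N.Linear K] {c : C} {x : N.obj c}
    (h : Generates N x) (e : C) : Module.Finite K (N.obj e) := by
  have := hC c e
  let φ : (c ⟶ e) →ₗ[K] N.obj e :=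
    { toFun := fun f => (N.map f).hom x
      map_add' := fun f g => map_add_apply N f g x
      map_smul' := fun r f => by rw [N.map_smul]; rfl }
  exact Module.Finite.of_surjective φ fun y => h e y

end Elements

/-! ### Finitely presented modules -/

section FinPres

variable {K : Type w} [Field K] {C : Type u} [Category.{v} C] [Preadditive C] [Linear K C]

noncomputable section

/-- The corepresentable module `C(c, -)`, lifted to the universe of `Mod(C)`. -/
def corep (K : Type w) [Field K] {C : Type u} [Category.{v} C] [Preadditive C] [Linear K C]
    (c : C) : Mod K C where
  obj :=
    { obj := fun e => ModuleCat.of K (ULift.{max u w} (c ⟶ e))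
      map := fun f => ModuleCat.ofHom (ULift.moduleEquiv.symm.toLinearMap ∘ₗ
        Linear.rightComp K c f ∘ₗ ULift.moduleEquiv.toLinearMap)
      map_id := fun _ => by ext f; simp
      map_comp := fun f g => by ext h; simp }
  property := ⟨⟨fun {_ _ f g} => by ext h; simp⟩, ⟨fun f r => by ext h; simp⟩⟩

/-- A morphism `f : c ⟶ e` as an element of `C(c, -)` at `e`. -/
def corepMk {c e : C} (f : c ⟶ e) : (corep K c).obj.obj e := ULift.up.{max u w} f

/-- The morphism `c ⟶ e` underlying an element of `C(c, -)` at `e`. -/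
def corepOut {c e : C} (y : (corep K c).obj.obj e) : c ⟶ e :=
  ULift.down (show ULift.{max u w} (c ⟶ e) from y)

lemma corepMk_out {c e : C} (y : (corep K c).obj.obj e) : corepMk (corepOut y) = y := rfl

lemma corep_map_mk {c d e : C} (f : c ⟶ d) (g : d ⟶ e) :
    ((corep K c).obj.map g).hom (corepMk f) = corepMk (f ≫ g) := rfl

/-- The Yoneda morphism `C(c, -) ⟶ N` with `1 ↦ x`. -/
def corepHom (N : Mod K C) {c : C} (x : N.obj.obj c) : corep K c ⟶ N :=
  ObjectProperty.homMk
    { app := fun e => ModuleCat.ofHom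
        { toFun := fun f : ULift.{max u w} (c ⟶ e) => (N.obj.map f.down).hom x
          map_add' := fun f g => map_add_apply N.obj f.down g.down x
          map_smul' := fun r f =>
            congrArg (fun h => h.hom x) (N.obj.map_smul r f.down) }
      naturality := fun d _ g =>
        ModuleCat.hom_ext (LinearMap.ext fun f : ULift.{max u w} (c ⟶ d) =>
          map_comp_apply N.obj f.down g x) }

lemma corep_hom_ext {N : Mod K C} {c : C} {α β : corep K c ⟶ N}
    (h : (α.hom.app c).hom (corepMk (𝟙 c)) = (β.hom.app c).hom (corepMk (𝟙 c))) : α = β := by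
  refine ObjectProperty.hom_ext _ (NatTrans.ext (funext fun e => ?_))
  refine ModuleCat.hom_ext (LinearMap.ext fun f => ?_)
  rw [← corepMk_out f, ← Category.id_comp (corepOut f), ← corep_map_mk, naturality_apply,
    naturality_apply, h]

/-- The cokernel of a morphism of modules, computed objectwise. -/
def coker {X Y : Mod K C} (p : X ⟶ Y) : Mod K C where
  obj :=
    { obj := fun c => ModuleCat.of K (Y.obj.obj c ⧸ LinearMap.range (p.hom.app c).hom)
      map := fun {_ _} f => ModuleCat.ofHom (Submodule.mapQ _ _ (Y.obj.map f).hom (by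
        rintro _ ⟨x, rfl⟩
        exact ⟨(X.obj.map f).hom x, naturality_apply p.hom f x⟩))
      map_id := fun _ => by ext x; simp
      map_comp := fun f g => by ext x; simp }
  property := ⟨⟨fun {_ _ f g} => by ext x; simp⟩, ⟨fun f r => by ext x; simp⟩⟩

/-- The projection of a module onto a cokernel. -/
def cokerProj {X Y : Mod K C} (p : X ⟶ Y) : Y ⟶ coker p :=
  ObjectProperty.homMk
    { app := fun _ => ModuleCat.ofHom (Submodule.mkQ _)
      naturality := fun _ _ _ => rfl }

lemma surjective_of_epi {X Y : Mod K C} (p : X ⟶ Y) [Epi p] (c : C) :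
    Function.Surjective (p.hom.app c).hom := by
  have h : p ≫ cokerProj p = p ≫ 0 := by
    refine ObjectProperty.hom_ext _ (NatTrans.ext (funext fun e => ?_))
    refine ModuleCat.hom_ext (LinearMap.ext fun x => ?_)
    exact (Submodule.Quotient.mk_eq_zero _).2 ⟨x, rfl⟩
  rw [cancel_epi] at h
  intro y
  have hy : ((cokerProj p).hom.app c).hom y = 0 := by rw [h]; rfl
  exact (Submodule.Quotient.mk_eq_zero _).1 hy

lemma projective_corep (c : C) : Projective (corep K c) where
  factors {X Y} f p hp := by
    obtain ⟨x, hx⟩ := surjective_of_epi p c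
      ((f.hom.app c).hom (corepMk (𝟙 c)))
    refine ⟨corepHom X x, corep_hom_ext ?_⟩
    rw [← hx]
    exact congrArg (p.hom.app c).hom (map_id_apply X.obj x)

lemma isFinGen_corep (c : C) : IsFinGen (corep K c) :=
  ⟨1, fun _ => c, fun _ => corepMk (𝟙 c),
    fun _ y => ⟨fun _ => corepOut y, by
      rw [Fin.sum_univ_one, corep_map_mk, Category.id_comp, corepMk_out]⟩⟩

lemma epi_of_surjective {X Y : Mod K C} (p : X ⟶ Y)
    (h : ∀ c, Function.Surjective (p.hom.app c).hom) : Epi p where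
  left_cancellation α β hαβ := by
    refine ObjectProperty.hom_ext _ (NatTrans.ext (funext fun e => ?_))
    refine ModuleCat.hom_ext (LinearMap.ext fun y => ?_)
    obtain ⟨x, rfl⟩ := h e y
    exact congrArg (fun f => (f.hom.app e).hom x) hαβ

lemma IsFinGen.exists_generates [Limits.HasFiniteBiproducts C] {N : Mod K C} (h : IsFinGen N) :
    ∃ (c : C) (x : N.obj.obj c), Generates N.obj x := by
  obtain ⟨n, c, x, hx⟩ := h
  refine ⟨⨁ c, ∑ i, (N.obj.map (Limits.biproduct.ι c i)).hom (x i), fun e y => ?_⟩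
  obtain ⟨f, rfl⟩ := hx e y
  refine ⟨Limits.biproduct.desc f, ?_⟩
  simp [map_sum, ← map_comp_apply]

/-- Over an additive category, the finitely presented modules are the cokernels of the maps
between corepresentable modules. A finitely generated projective module is a direct summand of a
corepresentable one, so the complementary idempotent can be put among the relations. -/
theorem isFinPres_iff [Limits.HasFiniteBiproducts C] (N : Mod K C) :
    IsFinPres N ↔ HasPresentation N.obj := by
  have := Limits.hasBinaryBiproducts_of_finite_biproducts C
  constructor
  · rintro ⟨P₁, P₀, g, f, h₁, -, h₀, hP, hex⟩
    obtain ⟨c, x, hx⟩ := h₀.exists_generates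
    obtain ⟨d, z, hz⟩ := h₁.exists_generates
    have : Epi (corepHom P₀ x) := epi_of_surjective _ fun e y => by
      obtain ⟨k, hk⟩ := hx e y
      exact ⟨corepMk k, hk⟩
    let σ : P₀ ⟶ corep K c := Projective.factorThru (𝟙 P₀) (corepHom P₀ x)
    have hσ : σ ≫ corepHom P₀ x = 𝟙 P₀ := Projective.factorThru_comp _ _
    let ε : c ⟶ c := corepOut ((σ.hom.app c).hom x)
    have hε : (P₀.obj.map ε).hom x = x := congrArg (fun h => (h.hom.app c).hom x) hσ
    -- `σ` sends `k • x` to `ε ≫ k`, so the relations of `x` are the `k` with `ε ≫ k = 0`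
    have hσε : ∀ (e : C) (k : c ⟶ e), (P₀.obj.map k).hom x = 0 → ε ≫ k = 0 := fun e k hk => by
      have h := naturality_apply σ.hom k x
      rw [hk, map_zero] at h
      exact (congrArg corepOut h).symm
    obtain ⟨ω, hω⟩ := hx d ((g.hom.app d).hom z)
    have hgen : Generates N.obj ((f.hom.app c).hom x) := fun e y => by
      obtain ⟨y, rfl⟩ := (hex e).2 y
      obtain ⟨k, rfl⟩ := hx e y
      exact ⟨k, (naturality_apply f.hom k x).symm⟩
    refine ⟨c, d ⊞ c, Limits.biprod.lift ω (𝟙 c - ε), (f.hom.app c).hom x, ?_, hgen,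
      fun e k hk => ?_⟩
    · rw [← naturality_apply]
      refine biprod_element_ext N.obj ?_ ?_
      · rw [← naturality_apply, ← map_comp_apply, Limits.biprod.lift_fst, hω, map_zero]
        exact ((hex d).1 _).2 ⟨z, rfl⟩
      · rw [← naturality_apply, ← map_comp_apply, Limits.biprod.lift_snd, map_sub_apply,
          map_id_apply, hε, sub_self, map_zero, map_zero]
    · rw [← naturality_apply] at hk
      obtain ⟨y, hy⟩ := ((hex e).1 _).1 hk
      obtain ⟨l, rfl⟩ := hz e y
      -- `k` differs from a multiple of `ω` by a relation of `x`, which is a multiple of `𝟙 - ε`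
      have h := hσε e (k - ω ≫ l) (by
        rw [map_sub_apply, map_comp_apply, hω, ← naturality_apply, hy, sub_self])
      refine ⟨Limits.biprod.desc l (k - ω ≫ l), ?_⟩
      rw [Limits.biprod.lift_desc, Preadditive.sub_comp, h, Category.id_comp]
      abel
  · rintro ⟨c, d, r, x, hx⟩
    refine ⟨corep K d, corep K c,
      corepHom (corep K c) (corepMk r), corepHom N x,
      isFinGen_corep d, projective_corep d, isFinGen_corep c, projective_corep c,
      fun e => ⟨fun k => ?_, fun y => ?_⟩⟩
    · change (N.obj.map (corepOut k)).hom x = 0 ↔ _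
      constructor
      · intro hk
        obtain ⟨g, hg⟩ := hx.exact _ hk
        exact ⟨corepMk g, congrArg corepMk hg⟩
      · rintro ⟨g, rfl⟩
        change (N.obj.map (r ≫ corepOut g)).hom x = 0
        rw [map_comp_apply, hx.relation, map_zero]
    · obtain ⟨k, hk⟩ := hx.generates e y
      exact ⟨corepMk k, hk⟩

end

end FinPres

/-! ### The triangular matrix category is a `Hom`-finite variety -/

section Variety

variable {K : Type w} [Field K] {U : Type u} [Category.{v} U] [Preadditive U] [Linear K U]
  {T : Type u} [Category.{v} T] [Preadditive T] [Linear K T] {M : Mod K (TensorCat K U Tᵒᵖ)}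

namespace Tri

/-- The matrix `[[t, 0], [m, u]]` as a morphism of the triangular matrix category. -/
def mat {X Y : Tri M} (t : X.t ⟶ Y.t) (m : M.obj.obj ⟨Y.u, op X.t⟩) (u : X.u ⟶ Y.u) : X ⟶ Y :=
  ⟨t, m, u⟩

section

variable {X Y : Tri M} (t : X.t ⟶ Y.t) (m : M.obj.obj ⟨Y.u, op X.t⟩) (u : X.u ⟶ Y.u)

@[simp] lemma mat_t : (mat t m u : X ⟶ Y).t = t := rfl
@[simp] lemma mat_m : (mat t m u : X ⟶ Y).m = m := rfl
@[simp] lemma mat_u : (mat t m u : X ⟶ Y).u = u := rfl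
@[simp] lemma zero_t : TriHom.t (0 : X ⟶ Y) = 0 := rfl
@[simp] lemma zero_m : TriHom.m (0 : X ⟶ Y) = 0 := rfl
@[simp] lemma zero_u : TriHom.u (0 : X ⟶ Y) = 0 := rfl

end

end Tri

@[simp] lemma actRight_zero {u : U} {t t' : T} (m : M.obj.obj ⟨u, op t'⟩) :
    actRight M (0 : t ⟶ t') m = 0 :=
  map_zero_apply (fixFst M u).obj m

@[simp] lemma actLeft_zero {u u' : U} {t : T} (m : M.obj.obj ⟨u, op t⟩) :
    actLeft M (0 : u ⟶ u') m = 0 :=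
  map_zero_apply (fixSnd M (op t)).obj m

lemma actLeft_sub {u u' : U} {t : T} (g h : u ⟶ u') (m : M.obj.obj ⟨u, op t⟩) :
    actLeft M (g - h) m = actLeft M g m - actLeft M h m :=
  map_sub_apply (fixSnd M (op t)).obj g h m

lemma Tri.isZero {t : T} {u : U} (ht : Limits.IsZero t) (hu : Limits.IsZero u) :
    Limits.IsZero (⟨t, u⟩ : Tri M) := by
  rw [Limits.IsZero.iff_id_eq_zero]
  refine Tri.hom_ext ?_ rfl ?_
  · exact ht.eq_of_src _ _
  · exact hu.eq_of_src _ _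

lemma Tri.hasFiniteBiproducts [Limits.HasFiniteBiproducts U] [Limits.HasFiniteBiproducts T] :
    Limits.HasFiniteBiproducts (Tri M) := by
  have := Limits.hasBinaryBiproducts_of_finite_biproducts U
  have := Limits.hasBinaryBiproducts_of_finite_biproducts T
  obtain ⟨t, ht⟩ := Limits.HasZeroObject.zero (C := T)
  obtain ⟨u, hu⟩ := Limits.HasZeroObject.zero (C := U)
  have : Limits.HasZeroObject (Tri M) := ⟨⟨t, u⟩, Tri.isZero ht hu⟩
  have : Limits.HasBinaryBiproducts (Tri M) := ⟨fun X Y =>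
    Limits.HasBinaryBiproduct.mk (Limits.BinaryBiproductData.mk
      { pt := ⟨X.t ⊞ Y.t, X.u ⊞ Y.u⟩
        fst := Tri.mat Limits.biprod.fst 0 Limits.biprod.fst
        snd := Tri.mat Limits.biprod.snd 0 Limits.biprod.snd
        inl := Tri.mat Limits.biprod.inl 0 Limits.biprod.inl
        inr := Tri.mat Limits.biprod.inr 0 Limits.biprod.inr
        inl_fst := by ext <;> simp
        inl_snd := by ext <;> simp
        inr_fst := by ext <;> simp
        inr_snd := by ext <;> simp }
      (Limits.isBinaryBilimitOfTotal _ (by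
        refine Tri.hom_ext ?_ ?_ ?_
        · exact Limits.biprod.total
        · simp
        · exact Limits.biprod.total)))⟩
  have : Limits.HasFiniteProducts (Tri M) :=
    hasFiniteProducts_of_has_binary_and_terminal
  exact Limits.HasFiniteBiproducts.of_hasFiniteProducts

/-- An idempotent `[[t, 0], [m, u]]` with `t = p ≫ i` and `u = q ≫ j` split is split by the
matrices `[[p, 0], [q • m, q]]` and `[[i, 0], [m • i, j]]`. -/
lemma Tri.isIdempotentComplete [IsIdempotentComplete U] [IsIdempotentComplete T] :
    IsIdempotentComplete (Tri M) where
  idempotents_split X f hf := by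
    have hm : actRight M f.t f.m + actLeft M f.u f.m = f.m := congrArg TriHom.m hf
    obtain ⟨t₀, i, p, hip, hpi⟩ :=
      IsIdempotentComplete.idempotents_split X.t f.t (congrArg TriHom.t hf)
    obtain ⟨u₀, j, q, hjq, hqj⟩ :=
      IsIdempotentComplete.idempotents_split X.u f.u (congrArg TriHom.u hf)
    -- multiplying `m = m • t + u • m` by `u` on the left gives `u • m • t = 0`
    have h₀ : actLeft M f.u (actRight M f.t f.m) = 0 := by
      have h := congrArg (actLeft M f.u) hm
      rw [map_add, ← actLeft_comp, show f.u ≫ f.u = f.u from congrArg TriHom.u hf] at h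
      simpa using h
    have hq : actLeft M q (actRight M i f.m) = 0 := by
      have h := congrArg (fun y => actRight M i (actLeft M q y)) h₀
      simp only [map_zero] at h
      rw [← actLeft_comp, actLeft_actRight, ← actRight_comp, ← hpi, ← hqj] at h
      rw [Category.assoc, hjq, Category.comp_id, ← Category.assoc, hip, Category.id_comp] at h
      rwa [actLeft_actRight]
    refine ⟨⟨t₀, u₀⟩, Tri.mat i (actRight M i f.m) j, Tri.mat p (actLeft M q f.m) q, ?_, ?_⟩
    · refine Tri.hom_ext hip ?_ hjq
      simp [← actLeft_actRight, hq]
    · refine Tri.hom_ext hpi ?_ hqj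
      simp only [Tri.comp_m, Tri.mat_m, Tri.mat_t, Tri.mat_u, ← actRight_comp, ← actLeft_comp,
        hpi, hqj, hm]

lemma small_of_generates {C : Type*} [Category* C] [LocallySmall.{s} C]
    {N : C ⥤ ModuleCat.{u₁} K} {c : C} {x : N.obj c} (h : Generates N x) (e : C) :
    Small.{s} (N.obj e) :=
  small_of_surjective (f := fun f : c ⟶ e => (N.map f).hom x) fun y => h e y

lemma Tri.essentiallySmall (hU : EssentiallySmall.{s} U) (hT : EssentiallySmall.{s} T)
    (hM : ∀ t : T, HasPresentation (fixSnd M (op t)).obj) : EssentiallySmall.{s} (Tri M) := by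
  have hsm : ∀ (t : T) (u : U), Small.{s} (M.obj.obj ⟨u, op t⟩) := fun t u => by
    obtain ⟨c, d, r, x, hx⟩ := hM t
    exact small_of_generates hx.generates u
  refine (essentiallySmall_iff (Tri M)).2 ⟨?_, ⟨fun X Y => ?_⟩⟩
  · let φ : Skeleton T × Skeleton U → Skeleton (Tri M) := fun p =>
      toSkeleton ⟨(fromSkeleton T).obj p.1, (fromSkeleton U).obj p.2⟩
    have hT' := ((essentiallySmall_iff T).1 hT).1
    have hU' := ((essentiallySmall_iff U).1 hU).1
    refine small_of_surjective (f := φ) fun X => ?_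
    obtain ⟨X, rfl⟩ := Quotient.mk_surjective X
    refine ⟨⟨toSkeleton X.t, toSkeleton X.u⟩, toSkeleton_eq_toSkeleton_iff.2 ⟨?_⟩⟩
    let α := fromSkeletonToSkeletonIso X.t
    let β := fromSkeletonToSkeletonIso X.u
    exact
      { hom := Tri.mat α.hom 0 β.hom
        inv := Tri.mat α.inv 0 β.inv
        hom_inv_id := by ext <;> simp
        inv_hom_id := by ext <;> simp }
  · have := hsm X.t Y.u
    exact small_of_injective (Tri.homEquiv X Y).injective

lemma Tri.finite_hom (hU : ∀ X Y : U, Module.Finite K (X ⟶ Y))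
    (hT : ∀ X Y : T, Module.Finite K (X ⟶ Y))
    (hM : ∀ t : T, HasPresentation (fixSnd M (op t)).obj) (X Y : Tri M) :
    Module.Finite K (X ⟶ Y) := by
  have := hU X.u Y.u
  have := hT X.t Y.t
  have : Module.Finite K (M.obj.obj ⟨Y.u, op X.t⟩) := by
    obtain ⟨c, d, r, x, hx⟩ := hM X.t
    exact hx.generates.finite hU Y.u
  let φ : (X ⟶ Y) →ₗ[K] (X.t ⟶ Y.t) × M.obj.obj ⟨Y.u, op X.t⟩ × (X.u ⟶ Y.u) :=
    { toFun := Tri.homEquiv X Y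
      map_add' := fun _ _ => rfl
      map_smul' := fun _ _ => rfl }
  exact Module.Finite.of_injective φ (Tri.homEquiv X Y).injective

/-- The entries `M(u, t)` are quotients of spaces of morphisms of `U`, as `M(-, t)` is finitely
generated; hence `Λ` inherits finiteness and smallness from `T` and `U`. -/
lemma Tri.isHomFiniteVariety (hU : IsHomFiniteVariety.{s} K U) (hT : IsHomFiniteVariety.{s} K T)
    (hM : ∀ t : T, HasPresentation (fixSnd M (op t)).obj) : IsHomFiniteVariety.{s} K (Tri M) := by
  have := hU.hasFiniteBiproducts
  have := hT.hasFiniteBiproducts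
  have := hU.isIdempotentComplete
  have := hT.isIdempotentComplete
  exact ⟨Tri.essentiallySmall hU.essentiallySmall hT.essentiallySmall hM,
    Tri.hasFiniteBiproducts, Tri.isIdempotentComplete, Tri.finite_hom hU.homFinite hT.homFinite hM⟩

end Variety

/-! ### Presentations of modules over the triangular matrix category -/

section Presentations

variable {K : Type w} [Field K] {U : Type u} [Category.{v} U] [Preadditive U] [Linear K U]
  {T : Type u} [Category.{v} T] [Preadditive T] [Linear K T] {M : Mod K (TensorCat K U Tᵒᵖ)}

lemma F_map_apply (X : CommaMod M) {P Q : Tri M} (f : P ⟶ Q) (x : X.left.obj.obj P.t)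
    (y : X.right.obj.obj P.u) :
    (((F M).obj X).obj.map f).hom (x, y) =
      ((X.left.obj.map f.t).hom x, dot X Q.u P.t f.m x + (X.right.obj.map f.u).hom y) :=
  rfl

/-- A presentation of `M(-, t)`, in terms of the left action. -/
lemma exists_actLeft_presentation {t : T} (h : HasPresentation (fixSnd M (op t)).obj) :
    ∃ (a b : U) (σ : a ⟶ b) (μ : M.obj.obj ⟨a, op t⟩), actLeft M σ μ = 0 ∧
      (∀ (u : U) (m : M.obj.obj ⟨u, op t⟩), ∃ l : a ⟶ u, actLeft M l μ = m) ∧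
      ∀ (u : U) (l : a ⟶ u), actLeft M l μ = 0 → ∃ g : b ⟶ u, σ ≫ g = l := by
  obtain ⟨a, b, σ, μ, hμ⟩ := h
  exact ⟨a, b, σ, μ, hμ.relation, hμ.generates, hμ.exact⟩

/-- If `x` generates `A` with relation `r` and `y` generates `B` with relation `r'`, then `(x, y)`
generates `A ⨿_f B`. A generator `μ` of `M(-, c)` satisfies `μ · x = B(j)(y)` for some `j`, which
gives, besides `r` and `r'`, the relation `[[0, 0], [μ, -j]]`. -/
theorem hasPresentation_F [Limits.HasBinaryBiproducts U] (X : CommaMod M)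
    (hM : ∀ t : T, HasPresentation (fixSnd M (op t)).obj)
    (hA : HasPresentation X.left.obj) (hB : HasPresentation X.right.obj) :
    HasPresentation ((F M).obj X).obj := by
  obtain ⟨c, d, r, x, hx⟩ := hA
  obtain ⟨c', d', r', y, hy⟩ := hB
  obtain ⟨w, -, -, μ, -, hμ, -⟩ := exists_actLeft_presentation (hM c)
  obtain ⟨j, hj⟩ := hy.generates w (dot X w c μ x)
  have hrel : dot X (w ⊞ d') c (actLeft M Limits.biprod.inl μ) x +
      (X.right.obj.map (Limits.biprod.lift (-j) r')).hom y = 0 := by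
    refine biprod_element_ext X.right.obj ?_ ?_
    · rw [dot_actLeft, map_add, ← map_comp_apply, ← map_comp_apply,
        Limits.biprod.inl_fst, Limits.biprod.lift_fst, map_id_apply, map_neg_apply, hj,
        add_neg_cancel, map_zero]
    · rw [dot_actLeft, map_add, ← map_comp_apply, ← map_comp_apply,
        Limits.biprod.inl_snd, Limits.biprod.lift_snd, map_zero_apply, hy.relation, add_zero,
        map_zero]
  -- with rows `d`, `w`, `d'`, the relation has the columns `(r, μ, 0)` and `(0, -j, r')`
  refine ⟨⟨c, c'⟩, ⟨d, w ⊞ d'⟩, Tri.mat r (actLeft M Limits.biprod.inl μ)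
    (Limits.biprod.lift (-j) r'), (x, y), Prod.ext hx.relation hrel, ?_, ?_⟩
  · rintro e ⟨a, b⟩
    obtain ⟨h, rfl⟩ := hx.generates e.t a
    obtain ⟨k, rfl⟩ := hy.generates e.u b
    refine ⟨Tri.mat h 0 k, ?_⟩
    rw [F_map_apply]
    simp only [Tri.mat_t, Tri.mat_m, Tri.mat_u, map_zero, LinearMap.zero_apply, zero_add]
    rfl
  · intro e f hf
    rw [F_map_apply] at hf
    obtain ⟨g, hg⟩ := hx.exact f.t (congrArg Prod.fst hf)
    have h₂ : dot X e.u c f.m x + (X.right.obj.map f.u).hom y = 0 := congrArg Prod.snd hf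
    obtain ⟨l, hl⟩ := hμ e.u f.m
    obtain ⟨g', hg'⟩ := hy.exact (j ≫ l + f.u) (by
      rw [map_add_apply, map_comp_apply, hj, ← dot_actLeft, hl, h₂])
    refine ⟨Tri.mat g 0 (Limits.biprod.desc l g'), Tri.hom_ext hg ?_ ?_⟩
    · simp only [Tri.comp_m, Tri.mat_m, Tri.mat_t, Tri.mat_u, map_zero, zero_add]
      rw [← actLeft_comp, Limits.biprod.inl_desc, hl]
    · simp only [Tri.comp_u, Tri.mat_u, Limits.biprod.lift_desc, hg']
      simp

end Presentations

/-! ### Modules over the triangular matrix category as triples -/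

section Triples

variable {K : Type w} [Field K] {U : Type u} [Category.{v} U] [Preadditive U] [Linear K U]
  {T : Type u} [Category.{v} T] [Preadditive T] [Linear K T] {M : Mod K (TensorCat K U Tᵒᵖ)}

noncomputable section

/-- Entries from `M(0, t)` vanish. -/
lemma eq_zero_of_isZero_left {o : U} (ho : Limits.IsZero o) {t : T}
    (m : M.obj.obj ⟨o, op t⟩) : m = 0 := by
  rw [← actLeft_id M m, ho.eq_of_src (𝟙 o) 0, actLeft_zero]

variable (M) in
/-- The inclusion `t ↦ (t, o)`, where `o` is a zero object of `U`. -/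
def inclT {o : U} (ho : Limits.IsZero o) : T ⥤ Tri M where
  obj t := ⟨t, o⟩
  map f := Tri.mat f 0 0
  map_id t := Tri.hom_ext rfl rfl (ho.eq_of_src _ _)
  map_comp f g := Tri.hom_ext rfl (by simp) (ho.eq_of_src _ _)

variable (M) in
/-- The inclusion `u ↦ (o, u)`, where `o` is a zero object of `T`. -/
def inclU {o : T} (ho : Limits.IsZero o) : U ⥤ Tri M where
  obj u := ⟨o, u⟩
  map f := Tri.mat 0 0 f
  map_id u := Tri.hom_ext (ho.eq_of_src _ _) rfl rfl
  map_comp f g := Tri.hom_ext (ho.eq_of_src _ _) (by simp) rfl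

instance {o : U} (ho : Limits.IsZero o) : (inclT M ho).Additive where
  map_add := Tri.hom_ext rfl (add_zero _).symm (add_zero _).symm

instance {o : U} (ho : Limits.IsZero o) : (inclT M ho).Linear K where
  map_smul {t _} _ r := Tri.hom_ext rfl (smul_zero (A := M.obj.obj ⟨o, op t⟩) r).symm
    (smul_zero (A := o ⟶ o) r).symm

instance {o : T} (ho : Limits.IsZero o) : (inclU M ho).Additive where
  map_add := Tri.hom_ext (add_zero _).symm (add_zero _).symm rfl

instance {o : T} (ho : Limits.IsZero o) : (inclU M ho).Linear K where
  map_smul {_ u'} _ r := Tri.hom_ext (smul_zero (A := o ⟶ o) r).symm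
    (smul_zero (A := M.obj.obj ⟨u', op o⟩) r).symm rfl

/-- The `T`-module `t ↦ N(t, o)`, where `o` is a zero object of `U`. -/
def restrictT (N : Mod K (Tri M)) {o : U} (ho : Limits.IsZero o) : Mod K T :=
  ⟨inclT M ho ⋙ N.obj, inferInstance, inferInstance⟩

/-- The `U`-module `u ↦ N(o, u)`, where `o` is a zero object of `T`. -/
def restrictU (N : Mod K (Tri M)) {o : T} (ho : Limits.IsZero o) : Mod K U :=
  ⟨inclU M ho ⋙ N.obj, inferInstance, inferInstance⟩

section

variable (N : Mod K (Tri M)) {oU : U} (hoU : Limits.IsZero oU) {oT : T} (hoT : Limits.IsZero oT)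

/-- The action of `M(u, t)` on a `Λ`-module `N`, as a bilinear map
`N(t, 0) → M(u, t) → N(0, u)`. -/
def triDot (oU : U) (oT : T) (t : T) (u : U) :
    N.obj.obj ⟨t, oU⟩ →ₗ[K] M.obj.obj ⟨u, op t⟩ →ₗ[K] N.obj.obj ⟨oT, u⟩ :=
  LinearMap.mk₂ K
    (fun x m => (N.obj.map (Tri.mat (X := ⟨t, oU⟩) (Y := ⟨oT, u⟩) 0 m 0)).hom x)
    (fun x x' m => map_add _ x x') (fun r x m => map_smul _ r x)
    (fun x m m' => by
      rw [← map_add_apply]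
      exact congrArg (fun f => (N.obj.map f).hom x) (Tri.hom_ext (by simp) rfl (by simp)))
    (fun r x m => by
      rw [← LinearMap.smul_apply, ← ModuleCat.hom_smul, ← N.obj.map_smul]
      exact congrArg (fun f => (N.obj.map f).hom x) (Tri.hom_ext (by simp) rfl (by simp)))

/-- The triple `(N(-, 0), f, N(0, -))` attached to a `Λ`-module `N`. -/
def toTriple : CommaMod M where
  left := restrictT N hoU
  right := restrictU N hoT
  hom := ObjectProperty.homMk
    { app := fun t => ModuleCat.ofHom
        { toFun := fun x => (ObjectProperty.homMk
            { app := fun u => ModuleCat.ofHom (triDot N oU oT t u x)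
              naturality := fun u u' g => by
                refine ModuleCat.hom_ext (LinearMap.ext fun m => ?_)
                refine Eq.trans ?_ (map_comp_apply N.obj
                  (Tri.mat (X := ⟨t, oU⟩) (Y := ⟨oT, u⟩) 0 m 0)
                  (Tri.mat (X := ⟨oT, u⟩) (Y := ⟨oT, u'⟩) 0 0 g) x)
                exact congrArg (fun f => (N.obj.map f).hom x)
                  (Tri.hom_ext Limits.zero_comp.symm (by simp; rfl) Limits.zero_comp.symm) } :
              (fixSndFunctor M).obj (op t) ⟶ restrictU N hoT)
          map_add' := fun x x' => by
            refine ObjectProperty.hom_ext _ (NatTrans.ext (funext fun u => ?_))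
            exact ModuleCat.hom_ext (map_add (triDot N oU oT t u) x x')
          map_smul' := fun r x => by
            refine ObjectProperty.hom_ext _ (NatTrans.ext (funext fun u => ?_))
            exact ModuleCat.hom_ext (map_smul (triDot N oU oT t u) r x) }
      naturality := fun t t' f => by
        refine ModuleCat.hom_ext (LinearMap.ext fun x => ?_)
        refine ObjectProperty.hom_ext _ (NatTrans.ext (funext fun u => ?_))
        refine ModuleCat.hom_ext (LinearMap.ext fun m => ?_)
        refine (map_comp_apply N.obj (Tri.mat (X := ⟨t, oU⟩) (Y := ⟨t', oU⟩) f 0 0)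
          (Tri.mat (X := ⟨t', oU⟩) (Y := ⟨oT, u⟩) 0 m 0) x).symm.trans ?_
        exact congrArg (fun f => (N.obj.map f).hom x)
          (Tri.hom_ext Limits.comp_zero (by simp; rfl) Limits.comp_zero) }

/-- The decomposition `N(t, u) ≅ N(t, 0) × N(0, u)`. -/
def decompose (P : Tri M) :
    N.obj.obj P ≃ₗ[K] N.obj.obj ⟨P.t, oU⟩ × N.obj.obj ⟨oT, P.u⟩ where
  toFun z := ((N.obj.map (Tri.mat (X := P) (Y := ⟨P.t, oU⟩) (𝟙 P.t) 0 0)).hom z,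
    (N.obj.map (Tri.mat (X := P) (Y := ⟨oT, P.u⟩) 0 0 (𝟙 P.u))).hom z)
  map_add' z z' := Prod.ext (map_add _ _ _) (map_add _ _ _)
  map_smul' r z := Prod.ext (map_smul _ _ _) (map_smul _ _ _)
  invFun p := (N.obj.map (Tri.mat (X := ⟨P.t, oU⟩) (Y := P) (𝟙 P.t) 0 0)).hom p.1 +
    (N.obj.map (Tri.mat (X := ⟨oT, P.u⟩) (Y := P) 0 0 (𝟙 P.u))).hom p.2
  left_inv z := by
    dsimp only
    rw [← map_comp_apply, ← map_comp_apply, ← map_add_apply]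
    refine Eq.trans ?_ (map_id_apply N.obj z)
    exact congrArg (fun f => (N.obj.map f).hom z) (Tri.hom_ext (by simp) (by simp) (by simp))
  right_inv p := by
    obtain ⟨x, y⟩ := p
    dsimp only
    simp only [map_add, ← map_comp_apply]
    refine Prod.ext ?_ ?_
    · refine Eq.trans (congrArg₂ (· + ·) ?_ ?_) (add_zero x)
      · refine Eq.trans ?_ (map_id_apply N.obj x)
        exact congrArg (fun f => (N.obj.map f).hom x)
          (Tri.hom_ext (by simp) (by simp) (hoU.eq_of_src _ _))
      · refine Eq.trans ?_ (map_zero_apply N.obj y)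
        exact congrArg (fun f => (N.obj.map f).hom y) (Tri.hom_ext (by simp) (by simp) (by simp))
    · refine Eq.trans (congrArg₂ (· + ·) ?_ ?_) (zero_add y)
      · refine Eq.trans ?_ (map_zero_apply N.obj x)
        exact congrArg (fun f => (N.obj.map f).hom x) (Tri.hom_ext (by simp) (by simp) (by simp))
      · refine Eq.trans ?_ (map_id_apply N.obj y)
        exact congrArg (fun f => (N.obj.map f).hom y)
          (Tri.hom_ext (hoT.eq_of_src _ _) (by simp) (by simp))

/-- Every `Λ`-module `N` is `A ⨿_f B` for the triple `(A, f, B) = (N(-, 0), f, N(0, -))`. -/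
def isoFToTriple : N ≅ (F M).obj (toTriple N hoU hoT) :=
  ObjectProperty.isoMk _ <|
    NatIso.ofComponents (fun P => (decompose N hoU hoT P).toModuleIso) (fun {P Q} f => by
      refine ModuleCat.hom_ext (LinearMap.ext fun z => ?_)
      refine Prod.ext ?_ ?_
      · refine (map_comp_apply N.obj f _ z).symm.trans
          (Eq.trans ?_ (map_comp_apply N.obj _ _ z))
        exact congrArg (fun f => (N.obj.map f).hom z) (Tri.hom_ext (by simp [inclT])
          (by simp [inclT]) (by simp [inclT]))
      · refine (map_comp_apply N.obj f _ z).symm.trans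
          (Eq.trans ?_ (congrArg₂ (· + ·) (map_comp_apply N.obj _ _ z)
            (map_comp_apply N.obj _ _ z)))
        rw [← map_add_apply]
        exact congrArg (fun f => (N.obj.map f).hom z) (Tri.hom_ext (by simp [inclU])
          (by simp [inclU]) (by simp [inclU])))

variable {N}

/-- If `z` generates `N` at `(c, c')`, its restriction to `c` generates `N(-, 0)`, and the entry in
`T` of the relation of `N` is the relation of `N(-, 0)`. -/
lemma hasPresentation_restrictT (h : HasPresentation N.obj) :
    HasPresentation (restrictT N hoU).obj := by
  obtain ⟨⟨c, c'⟩, ⟨d, d'⟩, r, z, hz⟩ := h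
  let p (t : T) (u : U) : (⟨t, u⟩ : Tri M) ⟶ ⟨t, oU⟩ := Tri.mat (𝟙 t) 0 0
  have hp (t : T) (f : c ⟶ t) : ((restrictT N hoU).obj.map f).hom ((N.obj.map (p c c')).hom z) =
      (N.obj.map (Tri.mat (X := ⟨c, c'⟩) (Y := ⟨t, oU⟩) f 0 0)).hom z := by
    refine (map_comp_apply N.obj (p c c') ((inclT M hoU).map f) z).symm.trans ?_
    exact congrArg (fun f => (N.obj.map f).hom z)
      (Tri.hom_ext (Category.id_comp f) (by simp [inclT]) Limits.comp_zero)
  refine ⟨c, d, r.t, (N.obj.map (p c c')).hom z, ?_, fun t y => ?_, fun t f hf => ?_⟩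
  · rw [hp, show Tri.mat (X := ⟨c, c'⟩) (Y := ⟨d, oU⟩) r.t 0 0 = r ≫ p d d' from
      Tri.hom_ext (Category.comp_id r.t).symm (by simp [p]) Limits.comp_zero.symm,
      map_comp_apply, hz.relation, map_zero]
    rfl
  · obtain ⟨f, rfl⟩ := hz.generates ⟨t, oU⟩ y
    refine ⟨f.t, (hp t f.t).trans ?_⟩
    exact congrArg (fun f => (N.obj.map f).hom z)
      (Tri.hom_ext rfl (eq_zero_of_isZero_left hoU f.m).symm (hoU.eq_of_tgt _ _))
  · obtain ⟨g, hg⟩ := hz.exact _ ((hp t f).symm.trans hf)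
    exact ⟨g.t, congrArg TriHom.t hg⟩

/-- If `z` generates `N` at `(c, c')` and `μ` generates `M(-, c)`, then `N(0, -)` is generated by
the restriction of `z` to `c'` and by `μ · z`. Its relations come from those of `N` and of
`M(-, c)`, together with generators of `M(-, d)` for the relation of `N` at `(d, d')`. -/
lemma hasPresentation_restrictU [Limits.HasBinaryBiproducts U]
    (hM : ∀ t : T, HasPresentation (fixSnd M (op t)).obj) (h : HasPresentation N.obj) :
    HasPresentation (restrictU N hoT).obj := by
  obtain ⟨⟨c, c'⟩, ⟨d, d'⟩, r, z, hz⟩ := h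
  obtain ⟨a, b, σ, μ, hσ, hμ, hμσ⟩ := exists_actLeft_presentation (hM c)
  obtain ⟨e, -, -, ν, -, hν, -⟩ := exists_actLeft_presentation (hM d)
  -- the relation `r` turns into `ν • r.t = α • μ` and `r.m = β • μ` in terms of the generator `μ`
  obtain ⟨α, hα⟩ := hμ e (actRight M r.t ν)
  obtain ⟨β, hβ⟩ := hμ d' r.m
  let y : N.obj.obj ⟨oT, c' ⊞ a⟩ := (N.obj.map (Tri.mat (X := ⟨c, c'⟩) (Y := ⟨oT, c' ⊞ a⟩) 0
    (actLeft M Limits.biprod.inr μ) Limits.biprod.inl)).hom z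
  have hy (u : U) (g : c' ⊞ a ⟶ u) : ((restrictU N hoT).obj.map g).hom y =
      (N.obj.map (Tri.mat (X := ⟨c, c'⟩) (Y := ⟨oT, u⟩) 0
        (actLeft M (Limits.biprod.inr ≫ g) μ) (Limits.biprod.inl ≫ g))).hom z := by
    refine (map_comp_apply N.obj _ ((inclU M hoT).map g) z).symm.trans ?_
    exact congrArg (fun f => (N.obj.map f).hom z)
      (Tri.hom_ext Limits.comp_zero (by simp [inclU, actLeft_comp]) rfl)
  let ιe : e ⟶ e ⊞ (d' ⊞ b) := Limits.biprod.inl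
  let ιd : d' ⟶ e ⊞ (d' ⊞ b) := Limits.biprod.inl ≫ Limits.biprod.inr
  let ιb : b ⟶ e ⊞ (d' ⊞ b) := Limits.biprod.inr ≫ Limits.biprod.inr
  refine ⟨c' ⊞ a, e ⊞ (d' ⊞ b), Limits.biprod.desc (r.u ≫ ιd) (α ≫ ιe + β ≫ ιd + σ ≫ ιb), y,
    ?_, fun u y' => ?_, fun u g hg => ?_⟩
  · rw [hy, Limits.biprod.inl_desc, Limits.biprod.inr_desc,
      show Tri.mat (X := ⟨c, c'⟩) (Y := ⟨oT, e ⊞ (d' ⊞ b)⟩) 0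
        (actLeft M (α ≫ ιe + β ≫ ιd + σ ≫ ιb) μ) (r.u ≫ ιd) =
          r ≫ Tri.mat (X := ⟨d, d'⟩) (Y := ⟨oT, e ⊞ (d' ⊞ b)⟩) 0 (actLeft M ιe ν) ιd from
        Tri.hom_ext Limits.comp_zero.symm (by
          simp only [Tri.mat_m, Tri.comp_m, Tri.mat_u]
          rw [actLeft_add, actLeft_add, actLeft_comp _ α, actLeft_comp _ β, actLeft_comp _ σ, hα,
            hβ, hσ, map_zero, add_zero, actLeft_actRight]) rfl,
      map_comp_apply, hz.relation, map_zero]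
    rfl
  · obtain ⟨f, rfl⟩ := hz.generates ⟨oT, u⟩ y'
    obtain ⟨l, hl⟩ := hμ u f.m
    refine ⟨Limits.biprod.desc f.u l, (hy u _).trans ?_⟩
    rw [Limits.biprod.inl_desc, Limits.biprod.inr_desc, hl]
    exact congrArg (fun f => (N.obj.map f).hom z) (Tri.hom_ext (hoT.eq_of_tgt _ _) rfl rfl)
  · obtain ⟨k, hk⟩ := hz.exact _ ((hy u g).symm.trans hg)
    obtain ⟨n, hn⟩ := hν u k.m
    -- the entries of `r ≫ k = [[0, 0], [g₂ • μ, g₁]]`, where `g = (g₁, g₂)`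
    have hku : r.u ≫ k.u = Limits.biprod.inl ≫ g := congrArg TriHom.u hk
    have hkm : actRight M r.t k.m + actLeft M k.u r.m = actLeft M (Limits.biprod.inr ≫ g) μ :=
      congrArg TriHom.m hk
    obtain ⟨γ, hγ⟩ := hμσ u (Limits.biprod.inr ≫ g - (α ≫ n + β ≫ k.u)) (by
      rw [actLeft_sub, actLeft_add, actLeft_comp _ α, actLeft_comp _ β, hα, hβ,
        actLeft_actRight, hn, hkm, sub_self])
    refine ⟨Limits.biprod.desc n (Limits.biprod.desc k.u γ), ?_⟩
    refine Limits.biprod.hom_ext' _ _ ?_ ?_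
    · simp [ιd, hku]
    · simp [ιd, ιe, ιb, hγ]

end

end

end Triples

/-! ### The dual of a module over the triangular matrix category -/

section Duality

variable {K : Type w} [Field K] {U : Type u} [Category.{v} U] [Preadditive U] [Linear K U]
  {T : Type u} [Category.{v} T] [Preadditive T] [Linear K T] {M : Mod K (TensorCat K U Tᵒᵖ)}

noncomputable section

/-- The isomorphism `W* × V* ≅ (V × W)*`, `(σ, τ) ↦ ((x, y) ↦ τ(x) + σ(y))`. -/
def dualProdEquiv (K : Type w) [Field K] (V W : Type*) [AddCommGroup V] [Module K V]
    [AddCommGroup W] [Module K W] :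
    (Module.Dual K W × Module.Dual K V) ≃ₗ[K] Module.Dual K (V × W) where
  toFun p := p.2.coprod p.1
  map_add' p q := by ext <;> simp
  map_smul' r p := by ext <;> simp
  invFun φ := (φ.comp (LinearMap.inr K V W), φ.comp (LinearMap.inl K V W))
  left_inv p := by ext <;> simp
  right_inv φ := by ext <;> simp

/-- The component of `ν` at a triple `(A, f, B)`, objectwise `B(u)* × A(t)* ≅ (A(t) × B(u))*`. -/
def nuApp (X : CommaMod M) :
    (Tstar M).obj ((F (bar M)).obj (ThetaObj X)) ≅ (D K (Tri M)).obj (op ((F M).obj X)) :=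
  ObjectProperty.isoMk _ <|
    NatIso.ofComponents
      (fun P => (dualProdEquiv K (X.left.obj.obj P.unop.t)
        (X.right.obj.obj P.unop.u)).toModuleIso) (fun {P Q} f => by
      refine ModuleCat.hom_ext (LinearMap.ext fun p => LinearMap.ext fun q => ?_)
      obtain ⟨(σ : Module.Dual K (X.right.obj.obj P.unop.u)),
        (τ : Module.Dual K (X.left.obj.obj P.unop.t))⟩ := p
      obtain ⟨x, y⟩ := q
      change σ (dot X P.unop.u Q.unop.t f.unop.m x) + τ ((X.left.obj.map f.unop.t).hom x) +
          σ ((X.right.obj.map f.unop.u).hom y) =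
        τ ((X.left.obj.map f.unop.t).hom x) +
          σ (dot X P.unop.u Q.unop.t f.unop.m x + (X.right.obj.map f.unop.u).hom y)
      rw [map_add]
      abel)

variable (M) in
/-- The natural isomorphism `ν : T* ∘ F̄ ∘ Θ ≅ D_Λ ∘ F`, on all of the comma category. -/
def nu : Theta M ⋙ F (bar M) ⋙ Tstar M ≅ (F M).op ⋙ D K (Tri M) :=
  NatIso.ofComponents (fun X => nuApp X.unop) (fun {X Y} α => by
    refine ObjectProperty.hom_ext _ (NatTrans.ext (funext fun P => ?_))
    refine ModuleCat.hom_ext (LinearMap.ext fun p => LinearMap.ext fun q => ?_)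
    rfl)

/-! ### The opposite of the triangular matrix category -/

instance : (toBar M).Full where
  map_surjective f := ⟨Quiver.Hom.op ⟨f.u.unop, f.m, f.t.unop⟩, rfl⟩

instance : (toBar M).Faithful where
  map_injective h := Quiver.Hom.unop_inj <|
    Tri.hom_ext (congrArg (fun k => k.u.unop) h) (congrArg (fun k => k.m) h)
      (congrArg (fun k => k.t.unop) h)

instance : (toBar M).EssSurj where
  mem_essImage Y := ⟨op ⟨Y.u.unop, Y.t.unop⟩, ⟨Iso.refl _⟩⟩

variable (M) in
/-- The isomorphism `Λ̄ ≅ Λᵒᵖ`, inverse to `toBar`. -/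
def fromBar : Tri (bar M) ⥤ (Tri M)ᵒᵖ where
  obj X := op ⟨X.u.unop, X.t.unop⟩
  map f := Quiver.Hom.op ⟨f.u.unop, f.m, f.t.unop⟩
  map_id _ := rfl
  map_comp f g := Quiver.Hom.unop_inj <| TriHom.ext rfl
    (add_comm (actRight (bar M) f.t g.m) (actLeft (bar M) g.u f.m)) rfl

instance : (fromBar M).Additive where
  map_add := rfl

instance : (fromBar M).Linear K where
  map_smul _ _ := rfl

instance : (fromBar M).Full where
  map_surjective f := ⟨⟨f.unop.u.op, f.unop.m, f.unop.t.op⟩, rfl⟩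

instance : (fromBar M).Faithful where
  map_injective h :=
    Tri.hom_ext (congrArg (fun k => k.unop.u.op) h) (congrArg (fun k => k.unop.m) h)
      (congrArg (fun k => k.unop.t.op) h)

instance : (fromBar M).EssSurj where
  mem_essImage Y := ⟨⟨op Y.unop.u, op Y.unop.t⟩, ⟨Iso.refl _⟩⟩

lemma hasFiniteBiproducts_op (C : Type*) [Category* C] [Preadditive C]
    [Limits.HasFiniteBiproducts C] : Limits.HasFiniteBiproducts Cᵒᵖ :=
  Limits.HasFiniteBiproducts.of_hasFiniteProducts

lemma hasPresentation_bar (hM : ∀ x : U, HasPresentation (fixFst M x).obj) (x : Uᵒᵖ) :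
    HasPresentation (fixSnd (bar M) (op x)).obj :=
  hM x.unop

/-- The module `M̄(-, t)` is `M(-, t)`, regarded as a functor on the double opposite of `U`. -/
lemma hasPresentation_fixFst_bar (hM : ∀ t : T, HasPresentation (fixSnd M (op t)).obj)
    (t : Tᵒᵖ) : HasPresentation (fixFst (bar M) t).obj :=
  (hM t.unop).comp (unopUnop U)

/-! ### Duality preserves finite presentation -/

/-- `D_C` takes modules with a presentation to modules with a presentation. -/
def DualPreserves (K : Type w) [Field K] (C : Type u) [Category.{v} C] [Preadditive C]
    [Linear K C] : Prop :=
  ∀ N : Mod K C, HasPresentation N.obj → HasPresentation (dualFunctor N.obj)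

/-- Writing a `Λ`-module as `A ⨿_f B`, its dual is `T*(D(B) ⨿ D(A))`, to which `hasPresentation_F`
applies. -/
theorem dualPreserves_tri [Limits.HasFiniteBiproducts U] [Limits.HasFiniteBiproducts T]
    (hMT : ∀ t : T, HasPresentation (fixSnd M (op t)).obj)
    (hMU : ∀ x : U, HasPresentation (fixFst M x).obj)
    (hU : DualPreserves K U) (hT : DualPreserves K T) : DualPreserves K (Tri M) := by
  intro N hN
  have := Limits.hasBinaryBiproducts_of_finite_biproducts U
  have := Limits.hasBinaryBiproducts_of_finite_biproducts T
  obtain ⟨oU, hoU⟩ := Limits.HasZeroObject.zero (C := U)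
  obtain ⟨oT, hoT⟩ := Limits.HasZeroObject.zero (C := T)
  let X := toTriple N hoU hoT
  have hF : HasPresentation ((F (bar M)).obj (ThetaObj X)).obj :=
    hasPresentation_F _ (hasPresentation_bar hMU) (hU _ (hasPresentation_restrictU hoT hMT hN))
      (hT _ (hasPresentation_restrictT hoU hN))
  have e : (Tstar M).obj ((F (bar M)).obj (ThetaObj X)) ≅ (D K (Tri M)).obj (op N) :=
    nuApp X ≪≫ (D K (Tri M)).mapIso (isoFToTriple N hoU hoT).op
  exact (hF.comp (toBar M)).of_iso ((isLinearFunctor K (Tri M)ᵒᵖ).ι.mapIso e)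

/-- The opposite category `Λᵒᵖ` is isomorphic to the triangular matrix category `Λ̄`. -/
theorem dualPreserves_tri_op [Limits.HasFiniteBiproducts U] [Limits.HasFiniteBiproducts T]
    (hMT : ∀ t : T, HasPresentation (fixSnd M (op t)).obj)
    (hMU : ∀ x : U, HasPresentation (fixFst M x).obj)
    (hU : DualPreserves K Uᵒᵖ) (hT : DualPreserves K Tᵒᵖ) : DualPreserves K (Tri M)ᵒᵖ := by
  intro N hN
  have := hasFiniteBiproducts_op U
  have := hasFiniteBiproducts_op T
  have h := dualPreserves_tri (M := bar M) (hasPresentation_bar hMU)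
    (hasPresentation_fixFst_bar hMT) hT hU
    ⟨fromBar M ⋙ N.obj, inferInstance, inferInstance⟩ (hN.comp (fromBar M))
  exact h.comp (toBar M).op

end

end Duality

/-! ### Dualizing varieties -/

section Dualizing

variable {K : Type w} [Field K] {C : Type u} [Category.{v} C] [Preadditive C] [Linear K C]

noncomputable section

/-- A functor with finite-dimensional values is isomorphic to its double dual. -/
def doubleDualIso (N : C ⥤ ModuleCat.{max u v w} K) (h : ∀ c, Module.Finite K (N.obj c)) :
    unopUnop C ⋙ N ≅ dualFunctor (dualFunctor N) :=
  NatIso.ofComponents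
    (fun c => haveI := h c.unop.unop; (Module.evalEquiv K (N.obj c.unop.unop)).toModuleIso)
    (fun _ => rfl)

/-- The form of `doubleDualIso` for modules over an opposite category. -/
def dualPredualIso (N : Cᵒᵖ ⥤ ModuleCat.{max u v w} K) (h : ∀ c, Module.Finite K (N.obj c)) :
    N ≅ dualFunctor (opOp C ⋙ dualFunctor N) :=
  NatIso.ofComponents
    (fun c => haveI := h c; (Module.evalEquiv K (N.obj c)).toModuleIso)
    (fun _ => rfl)

/-- Isomorphic contravariant functors have isomorphic restrictions. -/
def restrictOpIso {A : Type u₁} [Category.{v₁} A] {B : Type u₂} [Category.{v₂} B]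
    {P : ObjectProperty A} {Q : ObjectProperty B} {Φ Ψ : Aᵒᵖ ⥤ B} (e : Φ ≅ Ψ)
    (h : ∀ X, P X → Q (Φ.obj (op X))) (h' : ∀ X, P X → Q (Ψ.obj (op X))) :
    restrictOp P Q Φ h ≅ restrictOp P Q Ψ h' :=
  NatIso.ofComponents (fun X => ObjectProperty.isoMk _ (e.app (op X.unop.obj)))
    (fun f => ObjectProperty.hom_ext _ (e.hom.naturality f.unop.hom.op))

/-- Isomorphic functors have isomorphic duals. -/
def dualFunctorIso {N N' : C ⥤ ModuleCat.{max u v w} K} (e : N ≅ N') :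
    dualFunctor N' ≅ dualFunctor N :=
  NatIso.ofComponents
    (fun c => ((e.app c.unop).toLinearEquiv.dualMap).toModuleIso) (fun f => by
      refine ModuleCat.hom_ext (LinearMap.ext fun φ => LinearMap.ext fun x => ?_)
      exact congrArg (fun y => φ.toFun y) (naturality_apply e.hom f.unop x).symm)

lemma dualPreserves_iff [Limits.HasFiniteBiproducts C] :
    DualPreserves K C ↔ ∀ N : Mod K C, fp K C N → fp K Cᵒᵖ ((D K C).obj (op N)) := by
  have := hasFiniteBiproducts_op C
  exact forall_congr' fun N => imp_congr (isFinPres_iff N).symm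
    (isFinPres_iff ((D K C).obj (op N))).symm

lemma fp.finite (hC : IsHomFiniteVariety.{s} K C) {N : Mod K C} (h : fp K C N) (c : C) :
    Module.Finite K (N.obj.obj c) := by
  have := hC.hasFiniteBiproducts
  obtain ⟨_, _, _, _, hx⟩ := (isFinPres_iff N).1 h
  exact hx.generates.finite hC.homFinite c

lemma IsDualizingVariety.dualPreserves (hC : IsDualizingVariety.{s} K C) : DualPreserves K C := by
  have := hC.hasFiniteBiproducts
  obtain ⟨h, -⟩ := hC.duality
  exact dualPreserves_iff.2 h

/-- Every finitely presented `Cᵒᵖ`-module is the dual of some finitely presented `C`-module `X`, so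
that its own dual is the double dual of `X`, which is `X` again. -/
lemma IsDualizingVariety.dualPreserves_op (hC : IsDualizingVariety.{s} K C) :
    DualPreserves K Cᵒᵖ := by
  have := hC.hasFiniteBiproducts
  have := hasFiniteBiproducts_op C
  intro N hN
  obtain ⟨h, hE⟩ := hC.duality
  let Y : (fp K Cᵒᵖ).FullSubcategory := ⟨N, (isFinPres_iff N).2 hN⟩
  let X := (DRestrict K C h).objPreimage Y
  let e : (DRestrict K C h).obj X ≅ Y := (DRestrict K C h).objObjPreimageIso Y
  have hX : HasPresentation X.unop.obj.obj := (isFinPres_iff _).1 X.unop.property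
  let e' := dualFunctorIso
    ((isLinearFunctor K Cᵒᵖ).ι.mapIso ((fp K Cᵒᵖ).ι.mapIso e))
  exact (hX.comp (unopUnop C)).of_iso
    (doubleDualIso X.unop.obj.obj (fp.finite hC.toIsHomFiniteVariety X.unop.property) ≪≫ e'.symm)

/-- The linear map whose dual is the map `φ : V* → W*`, for `V` finite-dimensional. -/
def predualMap {V W : Type*} [AddCommGroup V] [Module K V] [AddCommGroup W] [Module K W]
    [Module.Finite K V] (φ : Module.Dual K V →ₗ[K] Module.Dual K W) : W →ₗ[K] V :=
  (Module.evalEquiv K V).symm.toLinearMap ∘ₗ φ.dualMap ∘ₗ Module.Dual.eval K W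

lemma apply_predualMap {V W : Type*} [AddCommGroup V] [Module K V] [AddCommGroup W] [Module K W]
    [Module.Finite K V] (φ : Module.Dual K V →ₗ[K] Module.Dual K W) (ξ : Module.Dual K V) (y : W) :
    ξ (predualMap φ y) = φ ξ y :=
  Module.apply_evalEquiv_symm_apply K V ξ _

lemma eq_of_forall_dual (K : Type*) [Field K] {V : Type*} [AddCommGroup V] [Module K V] {x y : V}
    (h : ∀ ξ : Module.Dual K V, ξ x = ξ y) : x = y :=
  sub_eq_zero.1 ((Module.forall_dual_apply_eq_zero_iff K _).1 fun ξ => by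
    rw [map_sub, h, sub_self])

/-- On finite-dimensional vector spaces the duality is fully faithful, and a finitely presented
`Cᵒᵖ`-module is the dual of its own dual, which is finitely presented by assumption. -/
theorem isEquivalence_DRestrict (hC : IsHomFiniteVariety.{s} K C) (hop : DualPreserves K Cᵒᵖ)
    (h : ∀ N : Mod K C, fp K C N → fp K Cᵒᵖ ((D K C).obj (op N))) :
    (DRestrict K C h).IsEquivalence := by
  have := hC.hasFiniteBiproducts
  have := hasFiniteBiproducts_op C
  have : (DRestrict K C h).Faithful := ⟨fun {X Y f g} hfg => by
    refine Quiver.Hom.unop_inj (ObjectProperty.hom_ext _ (ObjectProperty.hom_ext _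
      (NatTrans.ext (funext fun c => ModuleCat.hom_ext (LinearMap.ext fun y => ?_)))))
    refine eq_of_forall_dual K fun ξ => ?_
    exact congrArg (fun k => (show Module.Dual K (Y.unop.obj.obj.obj c) from
      (k.hom.hom.app (op c)).hom ξ) y) hfg⟩
  have : (DRestrict K C h).Full := ⟨fun {X Y} φ => by
    have hX := fp.finite hC X.unop.property
    let φ' (c : C) : Module.Dual K (X.unop.obj.obj.obj c) →ₗ[K]
        Module.Dual K (Y.unop.obj.obj.obj c) := (φ.hom.hom.app (op c)).hom
    let ψ : Y.unop.obj ⟶ X.unop.obj := ObjectProperty.homMk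
      { app := fun c => haveI := hX c; ModuleCat.ofHom (predualMap (φ' c))
        naturality := fun c d f => by
          have := hX c
          have := hX d
          refine ModuleCat.hom_ext (LinearMap.ext fun y => eq_of_forall_dual K fun ξ => ?_)
          change ξ (predualMap (φ' d) ((Y.unop.obj.obj.map f).hom y)) =
            (ξ.comp (X.unop.obj.obj.map f).hom) (predualMap (φ' c) y)
          rw [apply_predualMap, apply_predualMap]
          exact congrArg (fun χ : Module.Dual K (Y.unop.obj.obj.obj c) => χ y)
            (naturality_apply φ.hom.hom f.op ξ).symm }
    refine ⟨Quiver.Hom.op (ObjectProperty.homMk ψ), ?_⟩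
    refine ObjectProperty.hom_ext _ (ObjectProperty.hom_ext _
      (NatTrans.ext (funext fun c => ModuleCat.hom_ext
        (LinearMap.ext fun ξ => LinearMap.ext fun y => ?_))))
    have := hX c.unop
    exact apply_predualMap (φ' c.unop) ξ y⟩
  have : (DRestrict K C h).EssSurj := ⟨fun Y => by
    have hY : HasPresentation Y.obj.obj := (isFinPres_iff _).1 Y.property
    have hfin : ∀ c, Module.Finite K (Y.obj.obj.obj c) := by
      obtain ⟨_, _, _, _, hx⟩ := hY
      refine hx.generates.finite fun c d => ?_
      have := hC.homFinite d.unop c.unop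
      exact Module.Finite.of_surjective
        ({ toFun := Quiver.Hom.op, map_add' := fun _ _ => rfl, map_smul' := fun _ _ => rfl } :
          (d.unop ⟶ c.unop) →ₗ[K] (c ⟶ d)) fun f => ⟨f.unop, rfl⟩
    have hN : HasPresentation (opOp C ⋙ dualFunctor Y.obj.obj) :=
      (hop Y.obj hY).comp (opOp C)
    have hadd : (opOp C).Additive := ⟨rfl⟩
    have hlin : (opOp C).Linear K := ⟨fun _ _ => rfl⟩
    let N : Mod K C := ⟨opOp C ⋙ dualFunctor Y.obj.obj, inferInstance, inferInstance⟩
    exact ⟨op ⟨N, (isFinPres_iff N).2 hN⟩, ⟨ObjectProperty.isoMk _ (ObjectProperty.isoMk _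
      (dualPredualIso Y.obj.obj hfin).symm)⟩⟩⟩
  exact {}

end

end Dualizing

end TriangularMatrix

open TriangularMatrix in
theorem mainTheorem1 {K : Type w} [Field K]
    {U : Type u} [Category.{v} U] [Preadditive U] [Linear K U]
    {T : Type u} [Category.{v} T] [Preadditive T] [Linear K T]
    (hU : IsDualizingVariety.{s} K U) (hT : IsDualizingVariety.{s} K T)
    (M : Mod K (TensorCat K U Tᵒᵖ))
    (hMT : ∀ t : T, fp K U (fixSnd M (op t)))
    (hMU : ∀ x : U, fp K Tᵒᵖ (fixFst M x)) :
    (∃ (hF : ∀ X : CommaMod M, commaFp M X → fp K (Tri M) ((F M).obj X))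
      (hTheta : ∀ X : CommaMod M, commaFp M X → commaFp (bar M) ((Theta M).obj (op X)))
      (hTF : ∀ Y : CommaMod (bar M), commaFp (bar M) Y →
        fp K (Tri M)ᵒᵖ ((Tstar M).obj ((F (bar M)).obj Y)))
      (hD : ∀ N : Mod K (Tri M), fp K (Tri M) N → fp K (Tri M)ᵒᵖ ((D K (Tri M)).obj (op N))),
      Nonempty (ThetaRestrict hTheta ⋙ TstarFbarRestrict hTF ≅
        (FRestrict hF).op ⋙ DRestrict K (Tri M) hD) ∧
      (DRestrict K (Tri M) hD).IsEquivalence) ∧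
    IsDualizingVariety.{s} K (Tri M) := by
  have := hU.hasFiniteBiproducts
  have := hT.hasFiniteBiproducts
  have := hasFiniteBiproducts_op U
  have := hasFiniteBiproducts_op T
  have := Limits.hasBinaryBiproducts_of_finite_biproducts U
  have := Limits.hasBinaryBiproducts_of_finite_biproducts Tᵒᵖ
  have hMT' := fun t => (isFinPres_iff _).1 (hMT t)
  have hMU' := fun x => (isFinPres_iff _).1 (hMU x)
  have hΛ : IsHomFiniteVariety.{s} K (Tri M) :=
    Tri.isHomFiniteVariety hU.toIsHomFiniteVariety hT.toIsHomFiniteVariety hMT'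
  have := hΛ.hasFiniteBiproducts
  have := hasFiniteBiproducts_op (Tri M)
  have hD := dualPreserves_iff.1
    (dualPreserves_tri hMT' hMU' hU.dualPreserves hT.dualPreserves)
  have hE := isEquivalence_DRestrict hΛ
    (dualPreserves_tri_op hMT' hMU' hU.dualPreserves_op hT.dualPreserves_op) hD
  have hF : ∀ X : CommaMod M, commaFp M X → fp K (Tri M) ((F M).obj X) := fun X hX =>
    (isFinPres_iff _).2
      (hasPresentation_F X hMT' ((isFinPres_iff _).1 hX.1) ((isFinPres_iff _).1 hX.2))
  have hTheta : ∀ X : CommaMod M, commaFp M X → commaFp (bar M) ((Theta M).obj (op X)) :=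
    fun X hX => ⟨dualPreserves_iff.1 hU.dualPreserves _ hX.2,
      dualPreserves_iff.1 hT.dualPreserves _ hX.1⟩
  have hTF : ∀ Y : CommaMod (bar M), commaFp (bar M) Y →
      fp K (Tri M)ᵒᵖ ((Tstar M).obj ((F (bar M)).obj Y)) := fun Y hY =>
    (isFinPres_iff _).2 ((hasPresentation_F Y (hasPresentation_bar hMU')
      ((isFinPres_iff _).1 hY.1) ((isFinPres_iff _).1 hY.2)).comp (toBar M))
  exact ⟨⟨hF, hTheta, hTF, hD,
    ⟨restrictOpIso (nu M) (fun X hX => hTF _ (hTheta X hX)) (fun X hX => hD _ (hF X hX))⟩, hE⟩,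
    ⟨hΛ, hD, hE⟩⟩
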